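/- Let $\mathcal X$ be a finite non-empty set and let $r(x,y)\ge 0$ ($x,y\in\mathcal X$) be transition rates with $\sum_y r(x,y)>0$ for every $x$, which are irreducible, i.e. any state can be reached from any other by successive jumps with positive rate. Let $g:\mathbb R\times\mathcal X\times\mathcal X\to\mathbb R$ be bounded, measurable in time, and $T$-periodic in time, with $T>0$. For $\lambda\in\mathbb R$ let $(X^\lambda_t)_{t\ge 0}$ be the time-inhomogeneous Markov jump process with rates $r^\lambda(t,x,y)=e^{\lambda g(t,x,y)}r(x,y)$: if it is in $x$ after a jump at time $s$ (or at the initial time $s=0$), it stays there until a random time $\tau$ with $P(\tau>t)=\exp\{-\int_s^t \sum_y r^\lambda(v,x,y)\,dv\}$ for $t\ge s$, and, given $\tau$, it then jumps to $y$ with probability $r^\lambda(\tau,x,y)/\sum_z r^\lambda(\tau,x,z)$. Then the unperturbed process ($\lambda=0$) has a unique invariant distribution $\pi$, and $\pi(x)>0$ for all $x$. For each $\lambda$ the chain $(X^\lambda_{nT})_{n\ge 0}$ has a unique invariant distribution $\pi_\lambda$; the process $X^\lambda$ started from $\pi_\lambda$ is called the oscillatory steady state (OSS), and $\pi_{\lambda,t}(x):=\mathbb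 P_{\pi_\lambda}(X^\lambda_t=x)$ denotes its marginal at time $t\ge 0$. Put $r^*(x,y):=\pi(y)r(y,x)/\pi(x)$, $$\mathcal L^*f(x):=\sum_{y}r^*(x,y)\,[f(y)-f(x)],\qquad \psi_t(x):=\sum_{y}\bigl(r^*(x,y)g(t,y,x)-r(x,y)g(t,x,y)\bigr).$$ ($\mathcal L^*$ is the adjoint in $L^2(\pi)$ of the generator of the unperturbed process.) (i) For every $x$ the map $\lambda\mapsto\pi_\lambda(x)$ is differentiable at $\lambda=0$, the function $s\mapsto e^{s\mathcal L^*}\psi_{-s}$ is integrable on $(0,\infty)$, and $a(x):=\partial_{\lambda=0}\pi_\lambda(x)/\pi(x)$ satisfies $$a=\int_0^\infty e^{s\mathcal L^*}\psi_{-s}\,ds .$$ (ii) For every $t\ge 0$ and every $x$ the map $\lambda\mapsto\pi_{\lambda,t}(x)$ is differentiable at $\lambda=0$, the function $s\mapsto e^{s\mathcal L^*}\psi_{t-s}$ is integrable on $(0,\infty)$, and $a_t(x):=\partial_{\lambda=0}\pi_{\lambda,t}(x)/\pi(x)$ satisfies $$a_t=\int_0^\infty e^{s\mathcal L^*}\psi_{t-s}\,ds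 .$$ -/

import Mathlib

open MeasureTheory ProbabilityTheory Set

/-- Transition rates `rate t x y` (from `x` to `y` at time `t`) of a time-inhomogeneous Markov jump
process on a finite set: measurable in time, nonnegative, uniformly bounded, and with total exit
rates that are uniformly bounded away from zero. -/
structure JumpRates (X : Type*) [Fintype X] where
  rate : ℝ → X → X → ℝ
  measurable_rate : ∀ x y, Measurable fun t => rate t x y
  rate_nonneg : ∀ t x y, 0 ≤ rate t x y
  rate_bounded : ∃ C : ℝ, ∀ t x y, rate t x y ≤ C
  exit_pos : ∃ c : ℝ, 0 < c ∧ ∀ t x, c ≤ ∑ y, rate t x y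

namespace JumpRates

variable {X : Type*} [Fintype X]

/-- The holding time parameter `r̂_t(x) = ∑ y, r_t(x, y)`. -/
noncomputable def exitRate (R : JumpRates X) (t : ℝ) (x : X) : ℝ := ∑ y, R.rate t x y

/-- Given that the process is at `p.2` since time `p.1`, this is the density at `q` (with respect to
Lebesgue times counting measure) of (time of the next jump, state after the next jump).
The next jump time `τ` satisfies `P(τ > t) = exp (- ∫ v in p.1..t, r̂_v(p.2))`, so it has the density
`r̂_u(p.2) * exp (- ∫ v in p.1..u, r̂_v(p.2))` on `u > p.1`; given `τ = u`, the new state is `y` with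
probability `r_u(p.2, y) / r̂_u(p.2)`. -/
noncomputable def jumpDensity (R : JumpRates X) (p q : ℝ × X) : ENNReal :=
  (Ioi p.1).indicator
    (fun u => ENNReal.ofReal (Real.exp (-∫ v in p.1..u, R.exitRate v p.2) * R.rate u p.2 q.2)) q.1

lemma exitRate_measurable (R : JumpRates X) (x : X) : Measurable fun t => R.exitRate t x := by
  unfold exitRate
  exact Finset.measurable_sum _ fun y _ => R.measurable_rate x y

lemma exitRate_nonneg (R : JumpRates X) (t : ℝ) (x : X) : 0 ≤ R.exitRate t x :=
  Finset.sum_nonneg fun y _ => R.rate_nonneg t x y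

lemma exitRate_bounded (R : JumpRates X) : ∃ C : ℝ, ∀ t x, ‖R.exitRate t x‖ ≤ C := by
  obtain ⟨C, hC⟩ := R.rate_bounded
  refine ⟨∑ _y : X, C, fun t x => ?_⟩
  rw [Real.norm_of_nonneg (R.exitRate_nonneg t x)]
  exact Finset.sum_le_sum fun y _ => hC t x y

lemma exitRate_intervalIntegrable (R : JumpRates X) (x : X) (a b : ℝ) :
    IntervalIntegrable (fun t => R.exitRate t x) volume a b := by
  obtain ⟨C, hC⟩ := R.exitRate_bounded
  refine (intervalIntegrable_const (c := C)).mono_fun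
    (R.exitRate_measurable x).aestronglyMeasurable (Filter.Eventually.of_forall fun t => ?_)
  exact (hC t x).trans (le_abs_self C)

/-- The survival probability `exp (- ∫ v in s..u, r̂_v(x))` of the holding time. -/
noncomputable def survival (R : JumpRates X) (s : ℝ) (x : X) (u : ℝ) : ℝ :=
  Real.exp (-∫ v in s..u, R.exitRate v x)

lemma integral_exit_density (R : JumpRates X) (s t : ℝ) (hst : s ≤ t) (x : X) :
    ∫ u in s..t, Real.exp (-∫ v in s..u, R.exitRate v x) * R.exitRate u x
      = 1 - R.survival s x t := by
  obtain ⟨C, hC⟩ := R.exitRate_bounded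
  have hint := R.exitRate_intervalIntegrable x
  have hC0 : 0 ≤ C := (norm_nonneg _).trans (hC 0 x)
  have key : ∀ a b : ℝ, s ≤ a → a ≤ b → ‖R.survival s x a - R.survival s x b‖ ≤ C * (b - a) := by
    intro a b ha hab
    have h1 : (∫ v in s..b, R.exitRate v x)
        = (∫ v in s..a, R.exitRate v x) + ∫ v in a..b, R.exitRate v x :=
      (intervalIntegral.integral_add_adjacent_intervals (hint s a) (hint a b)).symm
    have h2 : 0 ≤ ∫ v in s..a, R.exitRate v x :=
      intervalIntegral.integral_nonneg ha fun v _ => R.exitRate_nonneg v x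
    have h3 : 0 ≤ ∫ v in a..b, R.exitRate v x :=
      intervalIntegral.integral_nonneg hab fun v _ => R.exitRate_nonneg v x
    have h4 : ‖∫ v in a..b, R.exitRate v x‖ ≤ C * |b - a| :=
      intervalIntegral.norm_integral_le_of_norm_le_const fun v _ => hC v x
    rw [Real.norm_of_nonneg h3, abs_of_nonneg (sub_nonneg.2 hab)] at h4
    unfold survival
    rw [h1, neg_add, Real.exp_add]
    set I := ∫ v in s..a, R.exitRate v x
    set J := ∫ v in a..b, R.exitRate v x
    have e1 : Real.exp (-I) ≤ 1 := Real.exp_le_one_iff.2 (by linarith)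
    have e2 : Real.exp (-J) ≤ 1 := Real.exp_le_one_iff.2 (by linarith)
    have e3 := Real.add_one_le_exp (-J)
    have e4 := Real.exp_pos (-I)
    rw [Real.norm_of_nonneg (by nlinarith)]
    nlinarith
  have hlip : LipschitzOnWith C.toNNReal (R.survival s x) (uIcc s t) := by
    rw [uIcc_of_le hst]
    refine LipschitzOnWith.of_dist_le_mul fun a ha b hb => ?_
    rw [Real.coe_toNNReal _ hC0, dist_eq_norm, Real.dist_eq]
    rcases le_total a b with hab | hab
    · rw [abs_sub_comm, abs_of_nonneg (sub_nonneg.2 hab)]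
      exact key a b ha.1 hab
    · rw [norm_sub_rev, abs_of_nonneg (sub_nonneg.2 hab)]
      exact key b a hb.1 hab
  have hFTC := hlip.absolutelyContinuousOnInterval.integral_deriv_eq_sub
  have hder : ∫ u in s..t, deriv (R.survival s x) u
      = ∫ u in s..t, -(Real.exp (-∫ v in s..u, R.exitRate v x) * R.exitRate u x) := by
    refine intervalIntegral.integral_congr_ae ?_
    filter_upwards [(hint s t).ae_hasDerivAt_integral] with u hu hus
    have := ((hu (uIoc_subset_uIcc hus) s left_mem_uIcc).neg.exp).deriv
    rw [show R.survival s x = fun u => Real.exp (-∫ v in s..u, R.exitRate v x) from rfl]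
    refine Eq.trans this ?_
    simp
  rw [hder, intervalIntegral.integral_neg] at hFTC
  have hs : R.survival s x s = 1 := by simp [survival]
  linarith

lemma tendsto_survival (R : JumpRates X) (s : ℝ) (x : X) :
    Filter.Tendsto (R.survival s x) Filter.atTop (nhds 0) := by
  obtain ⟨c, hc, hcle⟩ := R.exit_pos
  have hint := R.exitRate_intervalIntegrable x
  refine Real.tendsto_exp_neg_atTop_nhds_zero.comp ?_
  refine Filter.tendsto_atTop_mono' (f₁ := fun u => c * (u - s)) Filter.atTop ?_ ?_
  · filter_upwards [Filter.eventually_ge_atTop s] with u hu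
    have := intervalIntegral.integral_mono_on hu (intervalIntegrable_const (c := c)) (hint s u)
      fun v _ => hcle v x
    simpa [mul_comm] using this
  · exact (Filter.tendsto_atTop_add_const_right _ (-s) Filter.tendsto_id).const_mul_atTop hc

lemma lintegral_exit_density (R : JumpRates X) (s : ℝ) (x : X) :
    ∫⁻ u in Ioi s, ENNReal.ofReal
      (Real.exp (-∫ v in s..u, R.exitRate v x) * R.exitRate u x) = 1 := by
  have hint := R.exitRate_intervalIntegrable x
  have hnn : ∀ u, 0 ≤ Real.exp (-∫ v in s..u, R.exitRate v x) * R.exitRate u x :=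
    fun u => mul_nonneg (Real.exp_pos _).le (R.exitRate_nonneg u x)
  have hcont : Continuous fun u => Real.exp (-∫ v in s..u, R.exitRate v x) :=
    Real.continuous_exp.comp (intervalIntegral.continuous_primitive hint s).neg
  have hlim : Filter.Tendsto
      (fun t => ∫ u in s..t, Real.exp (-∫ v in s..u, R.exitRate v x) * R.exitRate u x)
      Filter.atTop (nhds 1) := by
    have h := (tendsto_const_nhds (x := (1 : ℝ))).sub (R.tendsto_survival s x)
    rw [sub_zero] at h
    refine h.congr' ?_
    filter_upwards [Filter.eventually_ge_atTop s] with t ht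
    exact (R.integral_exit_density s t ht x).symm
  have hii : ∀ a b : ℝ, IntervalIntegrable
      (fun u => Real.exp (-∫ v in s..u, R.exitRate v x) * R.exitRate u x) volume a b :=
    fun a b => (hint a b).continuousOn_mul hcont.continuousOn
  have hI : IntegrableOn
      (fun u => Real.exp (-∫ v in s..u, R.exitRate v x) * R.exitRate u x) (Ioi s) := by
    refine integrableOn_Ioi_of_intervalIntegral_norm_tendsto 1 s (b := id)
      (fun t => ?_) Filter.tendsto_id ?_
    · rcases le_total s t with h | h
      · exact (intervalIntegrable_iff_integrableOn_Ioc_of_le h).1 (hii s t)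
      · rw [id, Ioc_eq_empty_of_le h]
        exact integrableOn_empty
    · simpa only [Real.norm_of_nonneg (hnn _), id] using hlim
  have hval := tendsto_nhds_unique (intervalIntegral_tendsto_integral_Ioi s hI Filter.tendsto_id)
    hlim
  rw [← ofReal_integral_eq_lintegral_ofReal hI (Filter.Eventually.of_forall hnn), hval,
    ENNReal.ofReal_one]

variable [MeasurableSpace X] [MeasurableSingletonClass X]

lemma measurable_jumpDensity (R : JumpRates X) :
    Measurable (Function.uncurry R.jumpDensity) := by
  have hF : ∀ x, Measurable fun p : ℝ × ℝ => ∫ v in p.1..p.2, R.exitRate v x := by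
    intro x
    have hint := R.exitRate_intervalIntegrable x
    have h0 : Continuous fun t => ∫ v in (0 : ℝ)..t, R.exitRate v x :=
      intervalIntegral.continuous_primitive hint 0
    have : (fun p : ℝ × ℝ => ∫ v in p.1..p.2, R.exitRate v x) = fun p =>
        (∫ v in (0 : ℝ)..p.2, R.exitRate v x) - ∫ v in (0 : ℝ)..p.1, R.exitRate v x := by
      funext p
      exact (intervalIntegral.integral_interval_sub_left (hint _ _) (hint _ _)).symm
    rw [this]
    exact ((h0.comp continuous_snd).sub (h0.comp continuous_fst)).measurable
  have hx : ∀ z : X × X, Measurable fun p : ℝ × ℝ => R.jumpDensity (p.1, z.1) (p.2, z.2) := by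
    intro z
    have : (fun p : ℝ × ℝ => R.jumpDensity (p.1, z.1) (p.2, z.2)) =
        {p : ℝ × ℝ | p.1 < p.2}.indicator fun p => ENNReal.ofReal
          (Real.exp (-∫ v in p.1..p.2, R.exitRate v z.1) * R.rate p.2 z.1 z.2) := by
      funext p
      simp [jumpDensity, indicator_apply]
    rw [this]
    refine Measurable.indicator ?_ (measurableSet_lt measurable_fst measurable_snd)
    exact ENNReal.measurable_ofReal.comp ((Real.measurable_exp.comp (hF z.1).neg).mul
      ((R.measurable_rate z.1 z.2).comp measurable_snd))
  have hj : Measurable fun q : (ℝ × ℝ) × (X × X) =>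
      R.jumpDensity (q.1.1, q.2.1) (q.1.2, q.2.2) :=
    measurable_from_prod_countable_left hx
  exact hj.comp (f := fun q : (ℝ × X) × (ℝ × X) => ((q.1.1, q.2.1), (q.1.2, q.2.2)))
    (by fun_prop)

/-- The transition kernel of the chain of (jump times, states after the jumps). -/
noncomputable def jumpKernel (R : JumpRates X) : Kernel (ℝ × X) (ℝ × X) :=
  Kernel.withDensity (Kernel.const (ℝ × X) ((volume : Measure ℝ).prod Measure.count)) R.jumpDensity

instance (R : JumpRates X) : IsMarkovKernel R.jumpKernel := by
  refine ⟨fun p => ⟨?_⟩⟩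
  have hm : Measurable (R.jumpDensity p) := R.measurable_jumpDensity.comp measurable_prodMk_left
  rw [jumpKernel, Kernel.withDensity_apply _ R.measurable_jumpDensity,
    withDensity_apply _ MeasurableSet.univ, Measure.restrict_univ, Kernel.const_apply,
    lintegral_prod _ hm.aemeasurable, ← R.lintegral_exit_density p.1 p.2,
    ← lintegral_indicator measurableSet_Ioi]
  refine lintegral_congr fun u => ?_
  rw [lintegral_count, tsum_fintype]
  simp only [jumpDensity, indicator_apply]
  split_ifs with hu
  · rw [← ENNReal.ofReal_sum_of_nonneg fun y _ =>
      mul_nonneg (Real.exp_pos _).le (R.rate_nonneg u p.2 y), ← Finset.mul_sum]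
    rfl
  · simp

/-- Initial law of the chain: the process starts at time `0` in a state with distribution `ν`. -/
noncomputable def startLaw (ν : X → ℝ) : Measure (ℝ × X) :=
  ∑ x, ENNReal.ofReal (ν x) • Measure.dirac ((0 : ℝ), x)

/-- The law of the sequence (jump time, state after the jump), `n = 0, 1, 2, …`, of the Markov jump
process with rates `R` and initial distribution `ν` at time `0`. -/
noncomputable def pathLaw (R : JumpRates X) (ν : X → ℝ) : Measure (ℕ → ℝ × X) :=
  Kernel.trajMeasure (X := fun _ => ℝ × X) (startLaw ν) fun n =>
    R.jumpKernel.comap (fun h : (i : Finset.Iic n) → ℝ × X => h ⟨n, Finset.mem_Iic.2 le_rfl⟩)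
      (measurable_pi_apply _)

open Classical in
/-- The state `X_t` at time `t`: the state entered at the `n`-th jump if
`τ_n ≤ t < τ_{n+1}`, and the cemetery state `none` if there is no such `n`. -/
noncomputable def stateAt (t : ℝ) (ω : ℕ → ℝ × X) : Option X :=
  if h : ∃ n, (ω n).1 ≤ t ∧ t < (ω (n + 1)).1 then some (ω (Nat.find h)).2 else none

/-- The marginal `P_ν(X_t = x)` at time `t` of the process with initial distribution `ν`. -/
noncomputable def marginal (R : JumpRates X) (ν : X → ℝ) (t : ℝ) (x : X) : ℝ :=
  (R.pathLaw ν).real {ω | stateAt t ω = some x}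

/-- `ν` is an invariant distribution of the process: started from `ν`, it has law `ν` at all
times. -/
def IsInvariant (R : JumpRates X) (ν : X → ℝ) : Prop :=
  ν ∈ stdSimplex ℝ X ∧ ∀ t, 0 ≤ t → R.marginal ν t = ν

/-- `ν` is an invariant distribution of the process observed at the times `0, T, 2T, …`
(for rates of period `T` in time); the process started from such a `ν` is the oscillatory steady
state. -/
def IsPeriodicInvariant (R : JumpRates X) (T : ℝ) (ν : X → ℝ) : Prop :=
  ν ∈ stdSimplex ℝ X ∧ R.marginal ν T = ν

end JumpRates

namespace MarkovChain

variable {X : Type*} [Fintype X]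

/-- Irreducibility: any state can be reached from any other one through positive rates. -/
def IsIrreducible (r : X → X → ℝ) : Prop :=
  ∀ x y, Relation.ReflTransGen (fun a b => 0 < r a b) x y

lemma exists_exit_lower_bound (r : X → X → ℝ) (hpos : ∀ x, 0 < ∑ y, r x y) :
    ∃ c : ℝ, 0 < c ∧ ∀ x, c ≤ ∑ y, r x y := by
  rcases isEmpty_or_nonempty X with h | h
  · exact ⟨1, one_pos, fun x => isEmptyElim x⟩
  · obtain ⟨x₀, hx₀⟩ := Finite.exists_min fun x => ∑ y, r x y
    exact ⟨_, hpos x₀, hx₀⟩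

lemma exists_rate_upper_bound (r : X → X → ℝ) (hr : ∀ x y, 0 ≤ r x y) :
    ∃ C : ℝ, ∀ x y, r x y ≤ C :=
  ⟨∑ x, ∑ y, r x y, fun x y =>
    (Finset.single_le_sum (fun y _ => hr x y) (Finset.mem_univ y)).trans
      (Finset.single_le_sum (f := fun x => ∑ y, r x y)
        (fun x _ => Finset.sum_nonneg fun y _ => hr x y) (Finset.mem_univ x))⟩

/-- The unperturbed process: the rates `r(x, y)` do not depend on time. -/
def unperturbed (r : X → X → ℝ) (hr : ∀ x y, 0 ≤ r x y) (hpos : ∀ x, 0 < ∑ y, r x y) :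
    JumpRates X where
  rate _ x y := r x y
  measurable_rate _ _ := measurable_const
  rate_nonneg _ x y := hr x y
  rate_bounded := (exists_rate_upper_bound r hr).imp fun _ h _ x y => h x y
  exit_pos := (exists_exit_lower_bound r hpos).imp fun _ h => ⟨h.1, fun _ x => h.2 x⟩

/-- The perturbed process: the rates are `exp (lam * g(t, x, y)) * r(x, y)`. -/
noncomputable def perturbed (r : X → X → ℝ) (hr : ∀ x y, 0 ≤ r x y)
    (hpos : ∀ x, 0 < ∑ y, r x y) (g : ℝ → X → X → ℝ) (hgm : ∀ x y, Measurable fun t => g t x y)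
    (hgb : ∃ G : ℝ, ∀ t x y, |g t x y| ≤ G) (lam : ℝ) : JumpRates X where
  rate t x y := Real.exp (lam * g t x y) * r x y
  measurable_rate x y := (Real.measurable_exp.comp ((hgm x y).const_mul lam)).mul_const _
  rate_nonneg t x y := mul_nonneg (Real.exp_pos _).le (hr x y)
  rate_bounded := by
    obtain ⟨G, hG⟩ := hgb
    obtain ⟨C, hC⟩ := exists_rate_upper_bound r hr
    refine ⟨Real.exp (|lam| * G) * C, fun t x y => ?_⟩
    refine mul_le_mul (Real.exp_le_exp.2 ?_) (hC x y) (hr x y) (Real.exp_pos _).le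
    exact (le_abs_self _).trans
      ((abs_mul _ _).le.trans (mul_le_mul_of_nonneg_left (hG t x y) (abs_nonneg _)))
  exit_pos := by
    obtain ⟨G, hG⟩ := hgb
    obtain ⟨c, hc, hcle⟩ := exists_exit_lower_bound r hpos
    refine ⟨Real.exp (-(|lam| * G)) * c, mul_pos (Real.exp_pos _) hc, fun t x => ?_⟩
    refine (mul_le_mul_of_nonneg_left (hcle x) (Real.exp_pos _).le).trans ?_
    rw [Finset.mul_sum]
    refine Finset.sum_le_sum fun y _ =>
      mul_le_mul_of_nonneg_right (Real.exp_le_exp.2 ?_) (hr x y)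
    have h := (neg_le_abs (lam * g t x y)).trans
      ((abs_mul _ _).le.trans (mul_le_mul_of_nonneg_left (hG t x y) (abs_nonneg _)))
    linarith

/-- The rates `r*(x, y) = π(y) r(y, x) / π(x)` of the time-reversed stationary process. -/
noncomputable def rStar (r : X → X → ℝ) (π : X → ℝ) (x y : X) : ℝ := π y * r y x / π x

/-- The adjoint in `L²(π)` of the generator,
`L* f (x) = ∑ y, r*(x, y) (f(y) - f(x))`, on the finite-dimensional space of functions on `X`. -/
noncomputable def LStar (r : X → X → ℝ) (π : X → ℝ) : (X → ℝ) →L[ℝ] (X → ℝ) :=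
  LinearMap.toContinuousLinearMap
    { toFun := fun f x => ∑ y, rStar r π x y * (f y - f x)
      map_add' := fun f h => by
        funext x
        simp only [Pi.add_apply, ← Finset.sum_add_distrib]
        exact Finset.sum_congr rfl fun y _ => by ring
      map_smul' := fun c f => by
        funext x
        simp only [Pi.smul_apply, smul_eq_mul, RingHom.id_apply, Finset.mul_sum]
        exact Finset.sum_congr rfl fun y _ => by ring }

/-- `ψ_t(x) = ∑ y, (r*(x, y) g(t, y, x) - r(x, y) g(t, x, y))`. -/
noncomputable def psi (r : X → X → ℝ) (g : ℝ → X → X → ℝ) (π : X → ℝ) (t : ℝ) (x : X) : ℝ :=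
  ∑ y, (rStar r π x y * g t y x - r x y * g t x y)

end MarkovChain

/-! To first order in λ the OSS solves a linear equation with the time-independent generator of `r`,
and that generator forgets its past exponentially fast on vectors of total mass zero.

Write A_λ(t) for the operator of the forward equation with the perturbed rates (`forwardGen`) and A
for the unperturbed one. The marginals p of the OSS satisfy p' = A_λ p = A p + F with F = (A_λ - A)
p. Starting n periods in the past, using variation of constants and periodicity, and letting n → ∞
gives the exact identity p_t - π = ∫_0^∞ e^{sA} F_{t-s} ds (`marginal_sub_eq_integral`). Each F_u
has total mass zero, so the integral is at most K sup ‖F‖ with K independent of λ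
(`exists_integrableOn_exp_forwardGen`). Since F = O(λ), also p - π = O(λ); hence F = λB + O(λ²),
where B_u is the forward operator with rates `r * g u` applied to π. The same bound yields the
derivative ∫_0^∞ e^{sA} B_{t-s} ds (`hasDerivAt_marginal`). Dividing by π conjugates A into L* and
turns B into ψ; statement (i) is the case t = 0 of (ii).

Two ingredients carry this. The forward equation is derived from the law of the jump chain by
counting the arrivals in a state in two ways (`marginal_forward`); conservation of mass then rules
out explosion. Irreducibility makes every transition probability over a positive time positive
(`marginal_pos`), so Dobrushin's contraction gives the unique invariant distributions and the
exponential decay.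

As g is only measurable in time, differential equations appear in integrated form, with Lipschitz
solutions differentiable almost everywhere. -/

namespace JumpRates

variable {X : Type*} [Fintype X]

/-! ### The law of the jump chain: one-step disintegration and order of the jump times -/

lemma survival_mul (R : JumpRates X) (s t u : ℝ) (x : X) :
    R.survival s x t * R.survival t x u = R.survival s x u := by
  have hint := R.exitRate_intervalIntegrable x
  unfold survival
  rw [← Real.exp_add, ← neg_add,
    intervalIntegral.integral_add_adjacent_intervals (hint s t) (hint t u)]

variable [MeasurableSpace X]

lemma isProbabilityMeasure_startLaw {ν : X → ℝ} (hν : ν ∈ stdSimplex ℝ X) :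
    IsProbabilityMeasure (startLaw ν) := by
  refine ⟨?_⟩
  simp only [startLaw, Measure.coe_finsetSum, Finset.sum_apply, Measure.smul_apply, measure_univ,
    smul_eq_mul, mul_one]
  rw [← ENNReal.ofReal_sum_of_nonneg fun x _ => hν.1 x, hν.2, ENNReal.ofReal_one]

variable [MeasurableSingletonClass X]

lemma isProbabilityMeasure_pathLaw (R : JumpRates X) {ν : X → ℝ} (hν : ν ∈ stdSimplex ℝ X) :
    IsProbabilityMeasure (R.pathLaw ν) := by
  have := isProbabilityMeasure_startLaw hν
  unfold pathLaw
  infer_instance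

lemma map_zero_pathLaw (R : JumpRates X) {ν : X → ℝ} (hν : ν ∈ stdSimplex ℝ X) :
    (R.pathLaw ν).map (fun ω => ω 0) = startLaw ν := by
  have := isProbabilityMeasure_startLaw hν
  have h : (R.pathLaw ν).map (Preorder.frestrictLe 0)
      = (startLaw ν).map (MeasurableEquiv.piUnique (fun _ : Finset.Iic 0 => ℝ × X)).symm := by
    rw [pathLaw, Kernel.trajMeasure, Measure.map_comp _ _ (by fun_prop),
      Kernel.traj_map_frestrictLe, Kernel.partialTraj_self, Measure.id_comp]
  have h2 := congrArg (fun m : Measure ((i : Finset.Iic 0) → ℝ × X) =>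
    m.map (fun z => z ⟨0, Finset.mem_Iic.2 le_rfl⟩)) h
  beta_reduce at h2
  rw [Measure.map_map (by fun_prop) (by fun_prop), Measure.map_map (by fun_prop) (by fun_prop)]
    at h2
  exact h2.trans Measure.map_id

/-- The Markov property of the jump chain: the trajectory kernel at step `n` reads only the last
coordinate, so conditioning on the first `n` jumps leaves an integral against `jumpKernel (ω n)`. -/
lemma lintegral_pathLaw_succ (R : JumpRates X) {ν : X → ℝ} (hν : ν ∈ stdSimplex ℝ X) (n : ℕ)
    {F : (ℝ × X) × (ℝ × X) → ENNReal} (hF : Measurable F) :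
    ∫⁻ ω, F (ω n, ω (n + 1)) ∂(R.pathLaw ν)
      = ∫⁻ ω, ∫⁻ q, F (ω n, q) ∂(R.jumpKernel (ω n)) ∂(R.pathLaw ν) := by
  have := isProbabilityMeasure_startLaw hν
  have := R.isProbabilityMeasure_pathLaw hν
  set κ : (n : ℕ) → Kernel ((i : Finset.Iic n) → ℝ × X) (ℝ × X) := fun n =>
    R.jumpKernel.comap (fun h : (i : Finset.Iic n) → ℝ × X => h ⟨n, Finset.mem_Iic.2 le_rfl⟩)
      (measurable_pi_apply _) with hκ
  have h := Kernel.map_frestrictLe_trajMeasure_compProd_eq_map_trajMeasure (X := fun _ => ℝ × X)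
    (μ₀ := startLaw ν) (κ := κ) (a := n)
  change (R.pathLaw ν).map _ ⊗ₘ κ n = (R.pathLaw ν).map _ at h
  have hG : Measurable fun z : ((i : Finset.Iic n) → ℝ × X) × (ℝ × X) =>
      F (z.1 ⟨n, Finset.mem_Iic.2 le_rfl⟩, z.2) := hF.comp (by fun_prop)
  have h2 := congrArg (fun m => ∫⁻ z, F (z.1 ⟨n, Finset.mem_Iic.2 le_rfl⟩, z.2) ∂m) h
  beta_reduce at h2
  rw [Measure.lintegral_compProd hG, lintegral_map hG (by fun_prop),
    lintegral_map hG.lintegral_kernel_prod_right' (by fun_prop)] at h2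
  exact h2.symm

lemma lintegral_jumpKernel (R : JumpRates X) (p : ℝ × X) {F : ℝ × X → ENNReal}
    (hF : Measurable F) :
    ∫⁻ q, F q ∂(R.jumpKernel p) = ∫⁻ u in Ioi p.1, ∑ y,
      ENNReal.ofReal (R.survival p.1 p.2 u * R.rate u p.2 y) * F (u, y) := by
  have hm : Measurable (R.jumpDensity p) := R.measurable_jumpDensity.comp measurable_prodMk_left
  rw [jumpKernel, Kernel.withDensity_apply _ R.measurable_jumpDensity, Kernel.const_apply,
    lintegral_withDensity_eq_lintegral_mul _ hm hF, lintegral_prod _ (hm.mul hF).aemeasurable,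
    ← lintegral_indicator measurableSet_Ioi]
  refine lintegral_congr fun u => ?_
  rw [lintegral_count, tsum_fintype]
  simp only [jumpDensity, indicator_apply, Pi.mul_apply]
  split_ifs with hu
  · rfl
  · simp

/-- Beyond `t` the jump density factors into the survival probability up to `t` and the exit density
restarted at `t`, which has total mass one. -/
lemma jumpKernel_Ioi (R : JumpRates X) (s t : ℝ) (hst : s ≤ t) (x : X) :
    R.jumpKernel (s, x) {q | t < q.1} = ENNReal.ofReal (R.survival s x t) := by
  have hS : MeasurableSet {q : ℝ × X | t < q.1} := measurableSet_lt measurable_const measurable_fst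
  rw [← lintegral_indicator_one hS,
    R.lintegral_jumpKernel _ (measurable_one.indicator hS)]
  have h1 : ∀ u, ∑ y, ENNReal.ofReal (R.survival s x u * R.rate u x y)
      * {q : ℝ × X | t < q.1}.indicator 1 (u, y) = (Ioi t).indicator (fun u =>
        ENNReal.ofReal (R.survival s x t) * ENNReal.ofReal
          (Real.exp (-∫ v in t..u, R.exitRate v x) * R.exitRate u x)) u := by
    intro u
    simp only [indicator_apply, mem_ofPred_eq, mem_Ioi, Pi.one_apply]
    split_ifs with hu
    · rw [← ENNReal.ofReal_mul (show 0 ≤ R.survival s x t from (Real.exp_pos _).le)]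
      simp only [mul_one]
      rw [← ENNReal.ofReal_sum_of_nonneg fun y _ =>
        mul_nonneg (show 0 ≤ R.survival s x u from (Real.exp_pos _).le) (R.rate_nonneg u x y),
        ← Finset.mul_sum, ← R.survival_mul s t u x, mul_assoc]
      rfl
    · simp
  simp only [h1]
  rw [lintegral_indicator measurableSet_Ioi, Measure.restrict_restrict measurableSet_Ioi,
    inter_eq_left.2 (Ioi_subset_Ioi hst), lintegral_const_mul' _ _ ENNReal.ofReal_ne_top,
    R.lintegral_exit_density, mul_one]

lemma jumpKernel_Iic (R : JumpRates X) (p : ℝ × X) : R.jumpKernel p {q | q.1 ≤ p.1} = 0 := by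
  have hS : MeasurableSet {q : ℝ × X | q.1 ≤ p.1} :=
    measurableSet_le measurable_fst measurable_const
  rw [← lintegral_indicator_one hS,
    R.lintegral_jumpKernel _ (measurable_one.indicator hS)]
  refine (setLIntegral_congr_fun measurableSet_Ioi (g := fun _ => 0) fun u hu => ?_).trans (by simp)
  refine Finset.sum_eq_zero fun y _ => ?_
  simp [not_le.2 (mem_Ioi.1 hu)]

lemma ae_jump_lt (R : JumpRates X) {ν : X → ℝ} (hν : ν ∈ stdSimplex ℝ X) :
    ∀ᵐ ω ∂(R.pathLaw ν), ∀ n, (ω n).1 < (ω (n + 1)).1 := by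
  rw [ae_all_iff]
  intro n
  have hS : MeasurableSet {z : (ℝ × X) × (ℝ × X) | z.2.1 ≤ z.1.1} :=
    measurableSet_le (by fun_prop) (by fun_prop)
  have h := R.lintegral_pathLaw_succ hν n (measurable_one.indicator hS)
  have h0 : ∀ p : ℝ × X, ∫⁻ q, {z : (ℝ × X) × (ℝ × X) | z.2.1 ≤ z.1.1}.indicator 1 (p, q)
      ∂(R.jumpKernel p) = 0 := by
    intro p
    rw [← R.jumpKernel_Iic p, ← lintegral_indicator_one
      (measurableSet_le measurable_fst measurable_const)]
    rfl
  simp only [h0, lintegral_zero] at h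
  have hS' : MeasurableSet {ω : ℕ → ℝ × X | (ω (n + 1)).1 ≤ (ω n).1} :=
    measurableSet_le (by fun_prop) (by fun_prop)
  rw [ae_iff]
  simp only [not_lt]
  rw [← lintegral_indicator_one hS', ← h]
  rfl

lemma ae_zero_pathLaw (R : JumpRates X) {ν : X → ℝ} (hν : ν ∈ stdSimplex ℝ X) :
    ∀ᵐ ω ∂(R.pathLaw ν), (ω 0).1 = 0 := by
  have hS : MeasurableSet {p : ℝ × X | p.1 = 0} := measurable_fst (measurableSet_singleton 0)
  have h : ∀ᵐ p ∂((R.pathLaw ν).map (fun ω => ω 0)), p.1 = 0 := by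
    rw [R.map_zero_pathLaw hν, ae_iff]
    have hS2 : MeasurableSet {p : ℝ × X | ¬ p.1 = 0} := hS.compl
    simp [startLaw, hS2]
  exact (ae_map_iff (measurable_pi_apply 0).aemeasurable hS).1 h

lemma pathLaw_start (R : JumpRates X) {ν : X → ℝ} (hν : ν ∈ stdSimplex ℝ X) (y : X) :
    R.pathLaw ν {ω | (ω 0).2 = y} = ENNReal.ofReal (ν y) := by
  classical
  have hS : MeasurableSet {p : ℝ × X | p.2 = y} := measurable_snd (measurableSet_singleton y)
  have h : (R.pathLaw ν).map (fun ω => ω 0) {p : ℝ × X | p.2 = y} = R.pathLaw ν {ω | (ω 0).2 = y} :=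
    Measure.map_apply (by fun_prop) hS
  rw [← h, R.map_zero_pathLaw hν]
  simp [startLaw, hS, indicator_apply]

end JumpRates

/-! ### Occupation and jump probabilities for a fixed number of jumps -/

namespace JumpRates

lemma measurableSet_state_time {X : Type*} [MeasurableSpace X]
    [MeasurableSingletonClass X] (x : X) (t : ℝ) :
    MeasurableSet {p : ℝ × X | p.2 = x ∧ p.1 ≤ t} :=
  (measurable_snd (measurableSet_singleton x)).inter
    (measurableSet_le measurable_fst measurable_const)

variable {X : Type*} [Fintype X]

lemma measurable_survival (R : JumpRates X) (x : X) :
    Measurable fun z : ℝ × ℝ => R.survival z.1 x z.2 := by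
  have h0 : Continuous fun t => ∫ v in (0 : ℝ)..t, R.exitRate v x :=
    intervalIntegral.continuous_primitive (R.exitRate_intervalIntegrable x) 0
  have h : (fun z : ℝ × ℝ => R.survival z.1 x z.2) = fun z =>
      Real.exp (∫ v in (0 : ℝ)..z.1, R.exitRate v x)
        * Real.exp (-∫ v in (0 : ℝ)..z.2, R.exitRate v x) := by
    funext z
    rw [← R.survival_mul z.1 0 z.2 x, survival, survival, intervalIntegral.integral_symm, neg_neg]
  rw [h]
  exact ((Real.continuous_exp.comp (h0.comp continuous_fst)).mul
    (Real.continuous_exp.comp (h0.comp continuous_snd).neg)).measurable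

variable [MeasurableSpace X] [MeasurableSingletonClass X]

/-- The probability that the `n`-th jump was to `x` and the process still sits there at time `t`. -/
noncomputable def stayProb (R : JumpRates X) (ν : X → ℝ) (n : ℕ) (t : ℝ) (x : X) : ENNReal :=
  R.pathLaw ν {ω | ((ω n).2 = x ∧ (ω n).1 ≤ t) ∧ t < (ω (n + 1)).1}

/-- The probability that the `n + 1`-st jump is from `x` to `y` and happens up to time `t`. -/
noncomputable def jumpProb (R : JumpRates X) (ν : X → ℝ) (n : ℕ) (t : ℝ) (x y : X) : ENNReal :=
  R.pathLaw ν {ω | (ω n).2 = x ∧ ((ω (n + 1)).2 = y ∧ (ω (n + 1)).1 ≤ t)}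

lemma measurable_stayProb (R : JumpRates X) {ν : X → ℝ} (hν : ν ∈ stdSimplex ℝ X) (n : ℕ) (x : X) :
    Measurable fun t => R.stayProb ν n t x := by
  have := R.isProbabilityMeasure_pathLaw hν
  have hS : MeasurableSet {z : ℝ × (ℕ → ℝ × X) |
      ((z.2 n).2 = x ∧ (z.2 n).1 ≤ z.1) ∧ z.1 < (z.2 (n + 1)).1} := by
    refine (MeasurableSet.inter ?_ ?_).inter ?_
    · exact (show Measurable fun z : ℝ × (ℕ → ℝ × X) => (z.2 n).2 by fun_prop)
        (measurableSet_singleton x)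
    · exact measurableSet_le (f := fun z : ℝ × (ℕ → ℝ × X) => (z.2 n).1) (g := fun z => z.1)
        (by fun_prop) (by fun_prop)
    · exact measurableSet_lt (f := fun z : ℝ × (ℕ → ℝ × X) => z.1) (g := fun z => (z.2 (n + 1)).1)
        (by fun_prop) (by fun_prop)
  exact measurable_measure_prodMk_left hS

lemma stayProb_eq_lintegral (R : JumpRates X) {ν : X → ℝ} (hν : ν ∈ stdSimplex ℝ X) (n : ℕ)
    (t : ℝ) (x : X) :
    R.stayProb ν n t x = ∫⁻ ω, {p : ℝ × X | p.2 = x ∧ p.1 ≤ t}.indicator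
      (fun p => ENNReal.ofReal (R.survival p.1 x t)) (ω n) ∂(R.pathLaw ν) := by
  have hS : MeasurableSet {z : (ℝ × X) × (ℝ × X) | (z.1.2 = x ∧ z.1.1 ≤ t) ∧ t < z.2.1} :=
    (measurable_fst (measurableSet_state_time x t)).inter
      (measurableSet_lt (f := fun _ : (ℝ × X) × (ℝ × X) => t) (g := fun z => z.2.1)
        (by fun_prop) (by fun_prop))
  have hS' : MeasurableSet {ω : ℕ → ℝ × X |
      ((ω n).2 = x ∧ (ω n).1 ≤ t) ∧ t < (ω (n + 1)).1} :=
    (show Measurable fun ω : ℕ → ℝ × X => (ω n, ω (n + 1)) by fun_prop) hS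
  have h := R.lintegral_pathLaw_succ hν n (measurable_one.indicator hS)
  classical
  rw [stayProb, ← lintegral_indicator_one hS']
  refine Eq.trans h (lintegral_congr fun ω => ?_)
  by_cases hω : (ω n).2 = x ∧ (ω n).1 ≤ t
  · rw [indicator_of_mem (show ω n ∈ {p : ℝ × X | p.2 = x ∧ p.1 ≤ t} from hω),
      ← R.jumpKernel_Ioi (ω n).1 t hω.2 x, ← lintegral_indicator_one
      (measurableSet_lt measurable_const measurable_fst), ← hω.1]
    refine lintegral_congr fun q => ?_
    simp only [indicator_apply, mem_ofPred_eq, hω.2, true_and, Pi.one_apply]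
  · rw [indicator_of_notMem (show ω n ∉ {p : ℝ × X | p.2 = x ∧ p.1 ≤ t} from hω)]
    refine (lintegral_congr fun q => ?_).trans lintegral_zero
    exact indicator_of_notMem (fun hz => hω hz.1) _

/-- The jump density at `u` is survival up to `u` times the rate at `u`. By Tonelli, averaging the
survival factor over the position of the `n`-th jump first turns it into the probability of sitting
in `x` at time `u`. -/
lemma jumpProb_eq_lintegral (R : JumpRates X) {ν : X → ℝ} (hν : ν ∈ stdSimplex ℝ X) (n : ℕ)
    (t : ℝ) (x y : X) :
    R.jumpProb ν n t x y
      = ∫⁻ u in Iic t, ENNReal.ofReal (R.rate u x y) * R.stayProb ν n u x := by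
  classical
  have := R.isProbabilityMeasure_pathLaw hν
  have hS : MeasurableSet {z : (ℝ × X) × (ℝ × X) | z.1.2 = x ∧ (z.2.2 = y ∧ z.2.1 ≤ t)} :=
    ((show Measurable fun z : (ℝ × X) × (ℝ × X) => z.1.2 by fun_prop)
      (measurableSet_singleton x)).inter (measurable_snd (measurableSet_state_time y t))
  have hS' : MeasurableSet {ω : ℕ → ℝ × X |
      (ω n).2 = x ∧ ((ω (n + 1)).2 = y ∧ (ω (n + 1)).1 ≤ t)} :=
    (show Measurable fun ω : ℕ → ℝ × X => (ω n, ω (n + 1)) by fun_prop) hS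
  have h := R.lintegral_pathLaw_succ hν n (measurable_one.indicator hS)
  have hmeas : Measurable fun z : ℝ × (ℕ → ℝ × X) => ENNReal.ofReal (R.rate z.1 x y) *
      {p : ℝ × X | p.2 = x ∧ p.1 ≤ z.1}.indicator
        (fun p => ENNReal.ofReal (R.survival p.1 x z.1)) (z.2 n) := by
    refine Measurable.mul (((R.measurable_rate x y).comp measurable_fst).ennreal_ofReal) ?_
    have e : (fun z : ℝ × (ℕ → ℝ × X) => {p : ℝ × X | p.2 = x ∧ p.1 ≤ z.1}.indicator
        (fun p => ENNReal.ofReal (R.survival p.1 x z.1)) (z.2 n))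
        = {z : ℝ × (ℕ → ℝ × X) | (z.2 n).2 = x ∧ (z.2 n).1 ≤ z.1}.indicator
          (fun z => ENNReal.ofReal (R.survival (z.2 n).1 x z.1)) := by
      funext z
      simp only [indicator_apply, mem_ofPred_eq]
    rw [e]
    refine Measurable.indicator ?_ (MeasurableSet.inter ?_ ?_)
    · exact ((R.measurable_survival x).comp
        (show Measurable fun z : ℝ × (ℕ → ℝ × X) => ((z.2 n).1, z.1) by fun_prop)).ennreal_ofReal
    · exact (show Measurable fun z : ℝ × (ℕ → ℝ × X) => (z.2 n).2 by fun_prop)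
        (measurableSet_singleton x)
    · exact measurableSet_le (f := fun z : ℝ × (ℕ → ℝ × X) => (z.2 n).1) (g := fun z => z.1)
        (by fun_prop) (by fun_prop)
  simp only [R.stayProb_eq_lintegral hν]
  rw [jumpProb, ← lintegral_indicator_one hS']
  simp_rw [← lintegral_const_mul' _ _ ENNReal.ofReal_ne_top]
  rw [lintegral_lintegral_swap hmeas.aemeasurable]
  refine Eq.trans h (lintegral_congr fun ω => ?_)
  refine (R.lintegral_jumpKernel _ ((measurable_one.indicator hS).comp
    measurable_prodMk_left)).trans ?_
  rw [← lintegral_indicator measurableSet_Ioi, ← lintegral_indicator measurableSet_Iic]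
  -- The jump kernel lives on times strictly after the `n`-th jump, whereas the occupation event
  -- includes that instant; the discrepancy is a null set of `u`.
  have hne : ∀ᵐ u : ℝ, u ≠ (ω n).1 := by simp [ae_iff]
  refine lintegral_congr_ae ?_
  filter_upwards [hne] with u hu
  simp only [Function.comp_apply, indicator_apply, mem_ofPred_eq, mem_Ioi, mem_Iic, Pi.one_apply]
  by_cases hx : (ω n).2 = x
  · subst hx
    by_cases hut : u ≤ t
    · rcases lt_or_gt_of_ne hu with h1 | h1
      · simp [not_lt.2 h1.le, not_le.2 h1]
      · simp only [h1, h1.le, hut, true_and, and_true, if_true, mul_ite, mul_one, mul_zero,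
          Finset.sum_ite_eq', Finset.mem_univ]
        rw [mul_comm, ENNReal.ofReal_mul (R.rate_nonneg _ _ _)]
    · simp [hut]
  · simp [hx]

end JumpRates

/-! ### From the path law to the Kolmogorov forward equation -/

namespace JumpRates

lemma measurableSet_stay {X : Type*} [MeasurableSpace X] [MeasurableSingletonClass X] (x : X)
    (n : ℕ) (t : ℝ) : MeasurableSet {ω : ℕ → ℝ × X |
      ((ω n).2 = x ∧ (ω n).1 ≤ t) ∧ t < (ω (n + 1)).1} :=
  (show Measurable fun ω : ℕ → ℝ × X => ω n by fun_prop) (measurableSet_state_time x t) |>.inter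
    (measurableSet_lt (f := fun _ : ℕ → ℝ × X => t) (g := fun ω => (ω (n + 1)).1)
        (by fun_prop) (by fun_prop))

lemma measurableSet_jump {X : Type*} [MeasurableSpace X] [MeasurableSingletonClass X] (x y : X)
    (n : ℕ) (t : ℝ) : MeasurableSet {ω : ℕ → ℝ × X |
      (ω n).2 = x ∧ ((ω (n + 1)).2 = y ∧ (ω (n + 1)).1 ≤ t)} :=
  ((show Measurable fun ω : ℕ → ℝ × X => (ω n).2 by fun_prop) (measurableSet_singleton x)).inter
    ((show Measurable fun ω : ℕ → ℝ × X => ω (n + 1) by fun_prop) (measurableSet_state_time y t))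

variable {X : Type*} [Fintype X] [MeasurableSpace X] [MeasurableSingletonClass X]

/-- Jump times increase strictly almost surely, so at most one index `n` has `t` in its holding
interval: the union over `n` is disjoint and the choice made by `Nat.find` is immaterial. -/
lemma pathLaw_stateAt (R : JumpRates X) {ν : X → ℝ} (hν : ν ∈ stdSimplex ℝ X) (t : ℝ) (x : X) :
    R.pathLaw ν {ω | stateAt t ω = some x} = ∑' n, R.stayProb ν n t x := by
  classical
  have hmono : ∀ᵐ ω ∂(R.pathLaw ν), StrictMono fun n => (ω n).1 := by
    filter_upwards [R.ae_jump_lt hν] with ω hω using strictMono_nat_of_lt_succ hω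
  have huniq : ∀ ω : ℕ → ℝ × X, StrictMono (fun n => (ω n).1) → ∀ m n,
      (ω m).1 ≤ t → t < (ω (m + 1)).1 → (ω n).1 ≤ t → t < (ω (n + 1)).1 → m = n := by
    intro ω hω m n h1 h2 h3 h4
    have a : m < n + 1 := hω.lt_iff_lt.1 (h1.trans_lt h4)
    have b : n < m + 1 := hω.lt_iff_lt.1 (h3.trans_lt h2)
    omega
  have heq : {ω | stateAt t ω = some x} =ᵐ[R.pathLaw ν]
      ⋃ n, {ω : ℕ → ℝ × X | ((ω n).2 = x ∧ (ω n).1 ≤ t) ∧ t < (ω (n + 1)).1} := by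
    refine Filter.eventuallyEq_set.2 ?_
    filter_upwards [hmono] with ω hω
    simp only [mem_ofPred_eq, mem_iUnion, stateAt]
    constructor
    · intro h
      split_ifs at h with hex
      exact ⟨Nat.find hex, ⟨Option.some.inj h, (Nat.find_spec hex).1⟩, (Nat.find_spec hex).2⟩
    · rintro ⟨n, ⟨h1, h2⟩, h3⟩
      have hex : ∃ n, (ω n).1 ≤ t ∧ t < (ω (n + 1)).1 := ⟨n, h2, h3⟩
      rw [dif_pos hex, huniq ω hω _ n (Nat.find_spec hex).1 (Nat.find_spec hex).2 h2 h3, h1]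
  rw [measure_congr heq, measure_iUnion₀ _ fun n => (measurableSet_stay x n t).nullMeasurableSet]
  · rfl
  · intro m n hmn
    refine measure_mono_null ?_ (ae_iff.1 hmono)
    rintro ω ⟨⟨⟨-, h1⟩, h2⟩, ⟨⟨-, h3⟩, h4⟩⟩ hω
    exact hmn (huniq ω hω m n h1 h2 h3 h4)

lemma stayProb_of_neg (R : JumpRates X) {ν : X → ℝ} (hν : ν ∈ stdSimplex ℝ X) (n : ℕ) {t : ℝ}
    (ht : t < 0) (x : X) : R.stayProb ν n t x = 0 := by
  refine measure_mono_null (t := {ω | ¬ ((∀ n, (ω n).1 < (ω (n + 1)).1) ∧ (ω 0).1 = 0)}) ?_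
    (ae_iff.1 ((R.ae_jump_lt hν).and (R.ae_zero_pathLaw hν)))
  rintro ω ⟨⟨-, h1⟩, -⟩ ⟨h2, h3⟩
  have := (strictMono_nat_of_lt_succ (f := fun n => (ω n).1) h2).monotone (Nat.zero_le n)
  simp only [h3] at this
  linarith

/-- After entering `x` by time `t`, the process either still waits there or has already made its
next jump; conversely a next jump by time `t` forces the entrance to be earlier. -/
lemma pathLaw_state_time (R : JumpRates X) {ν : X → ℝ} (hν : ν ∈ stdSimplex ℝ X) (n : ℕ)
    (t : ℝ) (x : X) :
    R.pathLaw ν {ω | (ω n).2 = x ∧ (ω n).1 ≤ t}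
      = R.stayProb ν n t x + ∑ y, R.jumpProb ν n t x y := by
  have hlt := R.ae_jump_lt hν
  have hsum : ∑ y, R.jumpProb ν n t x y = R.pathLaw ν {ω | (ω n).2 = x ∧ (ω (n + 1)).1 ≤ t} := by
    unfold jumpProb
    rw [← measure_biUnion_finset _ fun y _ => measurableSet_jump x y n t]
    · congr 1
      ext ω
      simp
    · intro y _ z _ hyz
      refine Set.disjoint_left.2 ?_
      rintro ω ⟨-, h1, -⟩ ⟨-, h2, -⟩
      exact hyz (h1.symm.trans h2)
  rw [hsum, stayProb, ← measure_union _]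
  · refine measure_congr (Filter.eventuallyEq_set.2 ?_)
    filter_upwards [hlt] with ω hω
    simp only [mem_ofPred_eq, mem_union]
    have := hω n
    grind
  · exact ((show Measurable fun ω : ℕ → ℝ × X => (ω n).2 by fun_prop)
      (measurableSet_singleton x)).inter (measurableSet_le
        (f := fun ω : ℕ → ℝ × X => (ω (n + 1)).1) (g := fun _ => t) (by fun_prop) (by fun_prop))
  · refine Set.disjoint_left.2 ?_
    rintro ω ⟨-, h1⟩ ⟨-, h2⟩
    exact absurd h1 (not_lt.2 h2)

lemma pathLaw_state_time_succ (R : JumpRates X) (ν : X → ℝ) (n : ℕ) (t : ℝ) (y : X) :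
    R.pathLaw ν {ω | (ω (n + 1)).2 = y ∧ (ω (n + 1)).1 ≤ t} = ∑ x, R.jumpProb ν n t x y := by
  unfold jumpProb
  rw [← measure_biUnion_finset _ fun x _ => measurableSet_jump x y n t]
  · congr 1
    ext ω
    simp
  · intro y _ z _ hyz
    refine Set.disjoint_left.2 ?_
    rintro ω ⟨h1, -⟩ ⟨h2, -⟩
    exact hyz (h1.symm.trans h2)

lemma marginal_nonneg (R : JumpRates X) (ν : X → ℝ) (t : ℝ) (x : X) : 0 ≤ R.marginal ν t x :=
  measureReal_nonneg

lemma marginal_le_one (R : JumpRates X) {ν : X → ℝ} (hν : ν ∈ stdSimplex ℝ X) (t : ℝ) (x : X) :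
    R.marginal ν t x ≤ 1 := by
  have := R.isProbabilityMeasure_pathLaw hν
  exact measureReal_le_one

lemma ofReal_marginal (R : JumpRates X) {ν : X → ℝ} (hν : ν ∈ stdSimplex ℝ X) (t : ℝ) (x : X) :
    ENNReal.ofReal (R.marginal ν t x) = ∑' n, R.stayProb ν n t x := by
  have := R.isProbabilityMeasure_pathLaw hν
  rw [marginal, ofReal_measureReal, R.pathLaw_stateAt hν]

lemma measurable_marginal (R : JumpRates X) {ν : X → ℝ} (hν : ν ∈ stdSimplex ℝ X) (x : X) :
    Measurable fun t => R.marginal ν t x := by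
  have h : (fun t => R.marginal ν t x) = fun t => (∑' n, R.stayProb ν n t x).toReal := by
    funext t
    rw [← R.ofReal_marginal hν, ENNReal.toReal_ofReal (R.marginal_nonneg ν t x)]
  rw [h]
  exact (Measurable.tsum fun n => R.measurable_stayProb hν n x).ennreal_toReal

/-- Both sides are the expected number of jumps from `x` to `y` up to time `t`. Bounded rates and
marginals at most one make it finite, so the balance of flows can later be read in the reals. -/
lemma tsum_jumpProb (R : JumpRates X) {ν : X → ℝ} (hν : ν ∈ stdSimplex ℝ X) {t : ℝ} (ht : 0 ≤ t)
    (x y : X) :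
    ∑' n, R.jumpProb ν n t x y
      = ENNReal.ofReal (∫ u in (0 : ℝ)..t, R.marginal ν u x * R.rate u x y) := by
  obtain ⟨C, hC⟩ := R.rate_bounded
  have hm : Measurable fun u => R.marginal ν u x * R.rate u x y :=
    (R.measurable_marginal hν x).mul (R.measurable_rate x y)
  have h0 : ∀ u, 0 ≤ R.marginal ν u x * R.rate u x y := fun u =>
    mul_nonneg (R.marginal_nonneg ν u x) (R.rate_nonneg u x y)
  have hC0 : 0 ≤ C := (R.rate_nonneg 0 x y).trans (hC 0 x y)
  have hint : IntegrableOn (fun u => R.marginal ν u x * R.rate u x y) (Ioc 0 t) := by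
    refine Measure.integrableOn_of_bounded (M := C) (by simp) hm.aestronglyMeasurable ?_
    refine Filter.Eventually.of_forall fun u => ?_
    rw [Real.norm_of_nonneg (h0 u)]
    have := R.marginal_le_one hν u x
    have := R.marginal_nonneg ν u x
    have := hC u x y
    nlinarith [R.rate_nonneg u x y]
  rw [intervalIntegral.integral_of_le ht, ofReal_integral_eq_lintegral_ofReal hint
    (Filter.Eventually.of_forall h0)]
  simp_rw [R.jumpProb_eq_lintegral hν]
  rw [← lintegral_tsum (f := fun n u => ENNReal.ofReal (R.rate u x y) * R.stayProb ν n u x)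
    fun n => (Measurable.mul (R.measurable_rate x y).ennreal_ofReal
      (R.measurable_stayProb hν n x)).aemeasurable]
  simp_rw [ENNReal.tsum_mul_left, ← R.ofReal_marginal hν]
  rw [← lintegral_indicator measurableSet_Iic, ← lintegral_indicator measurableSet_Ioc]
  -- The domains `Iic t` and `Ioc 0 t` differ by negative times, where the marginal vanishes, and by
  -- the null point 0.
  have hne : ∀ᵐ u : ℝ, u ≠ 0 := by simp [ae_iff]
  refine lintegral_congr_ae ?_
  filter_upwards [hne] with u hu
  rcases lt_or_gt_of_ne hu with h | h
  · have : R.marginal ν u x = 0 := by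
      have := R.ofReal_marginal hν u x
      simp only [R.stayProb_of_neg hν _ h, tsum_zero, ENNReal.ofReal_eq_zero] at this
      exact le_antisymm this (R.marginal_nonneg ν u x)
    simp [indicator_apply, this]
  · simp only [indicator_apply, mem_Iic, mem_Ioc, h, true_and]
    rw [mul_comm, ENNReal.ofReal_mul (R.marginal_nonneg ν u x)]

/-- The Kolmogorov forward equation in integrated form, as a balance of the flows into and out of
the state `y`. -/
theorem marginal_forward (R : JumpRates X) {ν : X → ℝ} (hν : ν ∈ stdSimplex ℝ X) {t : ℝ}
    (ht : 0 ≤ t) (y : X) :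
    R.marginal ν t y + ∑ z, ∫ u in (0 : ℝ)..t, R.marginal ν u y * R.rate u y z
      = ν y + ∑ x, ∫ u in (0 : ℝ)..t, R.marginal ν u x * R.rate u x y := by
  have := R.isProbabilityMeasure_pathLaw hν
  have hI : ∀ x z, 0 ≤ ∫ u in (0 : ℝ)..t, R.marginal ν u x * R.rate u x z := fun x z =>
    intervalIntegral.integral_nonneg ht fun u _ =>
      mul_nonneg (R.marginal_nonneg ν u x) (R.rate_nonneg u x z)
  -- The expected number of entrances into `y` up to time `t`, the initial state included, is
  -- counted twice: here by what happens after the entrance (still there, or gone to some `z`), in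
  -- `h2` by its origin (the start, or a jump from some `x`).
  have h1 : ∑' n, R.pathLaw ν {ω | (ω n).2 = y ∧ (ω n).1 ≤ t} = ENNReal.ofReal (R.marginal ν t y)
      + ∑ z, ENNReal.ofReal (∫ u in (0 : ℝ)..t, R.marginal ν u y * R.rate u y z) := by
    simp_rw [R.pathLaw_state_time hν, ← R.tsum_jumpProb hν ht]
    rw [ENNReal.tsum_add, R.ofReal_marginal hν]
    congr 1
    exact Summable.tsum_finsetSum fun _ _ => ENNReal.summable
  have h2 : ∑' n, R.pathLaw ν {ω | (ω n).2 = y ∧ (ω n).1 ≤ t} = ENNReal.ofReal (ν y)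
      + ∑ x, ENNReal.ofReal (∫ u in (0 : ℝ)..t, R.marginal ν u x * R.rate u x y) := by
    rw [tsum_eq_zero_add' ENNReal.summable]
    simp_rw [R.pathLaw_state_time_succ, ← R.tsum_jumpProb hν ht]
    congr 1
    · rw [← R.pathLaw_start hν]
      refine measure_congr (Filter.eventuallyEq_set.2 ?_)
      filter_upwards [R.ae_zero_pathLaw hν] with ω hω
      simp [hω, ht]
    · exact Summable.tsum_finsetSum fun _ _ => ENNReal.summable
  rw [h1, ← ENNReal.ofReal_sum_of_nonneg fun z _ => hI y z,
    ← ENNReal.ofReal_sum_of_nonneg fun x _ => hI x y,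
    ← ENNReal.ofReal_add (R.marginal_nonneg ν t y) (Finset.sum_nonneg fun z _ => hI y z),
    ← ENNReal.ofReal_add (hν.1 y) (Finset.sum_nonneg fun x _ => hI x y)] at h2
  exact (ENNReal.ofReal_eq_ofReal_iff (add_nonneg (R.marginal_nonneg ν t y)
    (Finset.sum_nonneg fun z _ => hI y z)) (add_nonneg (hν.1 y)
    (Finset.sum_nonneg fun x _ => hI x y))).1 h2

end JumpRates

/-! ### Linear equations with merely measurable coefficients -/

namespace LinearODE

variable {E : Type*} [NormedAddCommGroup E]

lemma intervalIntegrable_of_norm_le {f : ℝ → E} (hm : AEStronglyMeasurable f) {C : ℝ}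
    (hC : ∀ u, ‖f u‖ ≤ C) (a b : ℝ) : IntervalIntegrable f volume a b :=
  (intervalIntegrable_const (c := C)).mono_fun hm.restrict
    (Filter.Eventually.of_forall fun u => (hC u).trans (le_abs_self C))

variable [NormedSpace ℝ E]

/-- Grönwall's argument needs a differentiable function, and `f` is only integrable. It is applied
to `F u = ∫ ‖D‖` over `[0, u]`, whose derivative is `‖D u‖ ≤ C * F u` because `D` is continuous. -/
lemma intervalIntegral_eq_zero_of_norm_le {f : ℝ → E} [CompleteSpace E]
    (hf : ∀ a b, IntervalIntegrable f volume a b) {C : ℝ}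
    (h : ∀ u, 0 ≤ u → ‖f u‖ ≤ C * ‖∫ v in (0 : ℝ)..u, f v‖) {t : ℝ} (ht : 0 ≤ t) :
    ∫ v in (0 : ℝ)..t, f v = 0 := by
  set D : ℝ → E := fun u => ∫ v in (0 : ℝ)..u, f v with hD
  have hcont : Continuous D := intervalIntegral.continuous_primitive hf 0
  set F : ℝ → ℝ := fun u => ∫ v in (0 : ℝ)..u, ‖D v‖ with hF
  have hFd : ∀ u, HasDerivAt F ‖D u‖ u := fun u =>
    intervalIntegral.integral_hasDerivAt_right (hcont.norm.intervalIntegrable _ _)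
      (hcont.norm.stronglyMeasurableAtFilter _ _) hcont.norm.continuousAt
  have hDF : ∀ u, 0 ≤ u → ‖D u‖ ≤ C * F u := by
    intro u hu
    calc ‖D u‖ ≤ ∫ v in (0 : ℝ)..u, ‖f v‖ := intervalIntegral.norm_integral_le_integral_norm hu
      _ ≤ ∫ v in (0 : ℝ)..u, C * ‖D v‖ :=
          intervalIntegral.integral_mono_on hu (hf 0 u).norm
            ((hcont.norm.intervalIntegrable _ _).const_mul C) fun v hv => h v hv.1
      _ = C * F u := intervalIntegral.integral_const_mul _ _
  have hF0 : ∀ u, 0 ≤ u → 0 ≤ F u := fun u hu =>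
    intervalIntegral.integral_nonneg hu fun v _ => norm_nonneg _
  have hz : F t = 0 := eq_zero_of_abs_deriv_le_mul_abs_self_of_eq_zero_right (f := F) (K := C)
    (a := 0) (b := t) (fun u _ => (hFd u).continuousAt.continuousWithinAt)
    (fun u _ => (hFd u).hasDerivWithinAt) (by simp [hF])
    (fun u hu => by
      rw [norm_norm, Real.norm_of_nonneg (hF0 u hu.1)]
      exact hDF u hu.1) t ⟨ht, le_rfl⟩
  have := hDF t ht
  rw [hz, mul_zero] at this
  exact norm_le_zero_iff.1 this

lemma hasDerivAt_exp_sub_smul [CompleteSpace E] (A : E →L[ℝ] E) (t s : ℝ) :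
    HasDerivAt (fun s : ℝ => NormedSpace.exp ((t - s) • A))
      (-(NormedSpace.exp ((t - s) • A) * A)) s := by
  have h := (hasDerivAt_exp_smul_const (𝕂 := ℝ) A (t - s)).scomp s
    ((hasDerivAt_id s).const_sub t)
  exact h.congr_deriv (by simp)

/-- Variation of constants for absolutely continuous solutions with a bounded inhomogeneity. -/
theorem duhamel [CompleteSpace E] (A : E →L[ℝ] E) {h f : ℝ → E} {p₀ : E}
    (hh : ∀ a b, IntervalIntegrable h volume a b) (hf : ∀ a b, IntervalIntegrable f volume a b)
    {M : ℝ} (hhM : ∀ u, ‖h u‖ ≤ M) (hfM : ∀ u, ‖f u‖ ≤ M) {t : ℝ} (ht : 0 ≤ t)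
    (heq : ∀ u, 0 ≤ u → h u = A (p₀ + ∫ v in (0 : ℝ)..u, h v) + f u) :
    p₀ + ∫ v in (0 : ℝ)..t, h v = NormedSpace.exp (t • A) p₀ +
      ∫ s in (0 : ℝ)..t, NormedSpace.exp (s • A) (f (t - s)) := by
  set P : ℝ → E := fun u => p₀ + ∫ v in (0 : ℝ)..u, h v with hP
  set Φ : ℝ → E →L[ℝ] E := fun s => NormedSpace.exp ((t - s) • A) with hΦ
  have hΦd : ∀ s, HasDerivAt Φ (-(Φ s * A)) s := hasDerivAt_exp_sub_smul A t
  have hΦc : Continuous Φ := continuous_iff_continuousAt.2 fun s => (hΦd s).continuousAt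
  have hPc : Continuous P := continuous_const.add (intervalIntegral.continuous_primitive hh 0)
  have hM : 0 ≤ M := (norm_nonneg _).trans (hhM 0)
  have hΦf : ∀ a b, IntervalIntegrable (fun s => Φ s (f s)) volume a b := by
    intro a b
    obtain ⟨B, hB⟩ := (isCompact_uIcc (a := a) (b := b)).exists_bound_of_continuousOn
      hΦc.continuousOn
    refine (intervalIntegrable_const (c := B * M)).mono_fun ?_ ?_
    · exact (ContinuousLinearMap.apply ℝ E).flip.aestronglyMeasurable_comp₂
        hΦc.aestronglyMeasurable (hf a b).aestronglyMeasurable_restrict_uIoc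
    · refine (ae_restrict_iff' measurableSet_uIoc).2 (Filter.Eventually.of_forall fun s hs => ?_)
      have h1 := hB s (uIoc_subset_uIcc hs)
      have h2 : 0 ≤ B := (norm_nonneg _).trans h1
      rw [Real.norm_of_nonneg (mul_nonneg h2 hM)]
      exact ((Φ s).le_opNorm _).trans (mul_le_mul h1 (hfM s) (norm_nonneg _) h2)
  obtain ⟨B, hB⟩ := (isCompact_uIcc (a := 0) (b := t)).exists_bound_of_continuousOn
    hΦc.continuousOn
  obtain ⟨D, hD⟩ := (isCompact_uIcc (a := 0) (b := t)).exists_bound_of_continuousOn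
    hPc.continuousOn
  have hB0 : 0 ≤ B := (norm_nonneg _).trans (hB 0 left_mem_uIcc)
  have hD0 : 0 ≤ D := (norm_nonneg _).trans (hD 0 left_mem_uIcc)
  -- The conserved quantity of variation of constants. It is Lipschitz on `[0, t]` with derivative
  -- zero almost everywhere, hence constant; comparing its values at `0` and `t` gives the formula.
  set w : ℝ → E := fun s => Φ s (P s) - ∫ u in (0 : ℝ)..s, Φ u (f u) with hw
  have hPlip : ∀ a b, ‖P a - P b‖ ≤ M * ‖a - b‖ := by
    intro a b
    have : P a - P b = ∫ v in b..a, h v := by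
      simp only [hP, add_sub_add_left_eq_sub]
      exact intervalIntegral.integral_interval_sub_left (hh _ _) (hh _ _)
    rw [this]
    exact intervalIntegral.norm_integral_le_of_norm_le_const fun v _ => hhM v
  have hΦlip : ∀ a ∈ uIcc 0 t, ∀ b ∈ uIcc 0 t, ‖Φ a - Φ b‖ ≤ B * ‖A‖ * ‖a - b‖ := by
    intro a ha b hb
    refine (convex_uIcc 0 t).norm_image_sub_le_of_norm_hasDerivWithin_le
      (fun s _ => (hΦd s).hasDerivWithinAt) (fun s hs => ?_) hb ha
    rw [norm_neg]
    exact (norm_mul_le _ _).trans (mul_le_mul_of_nonneg_right (hB s hs) (norm_nonneg _))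
  have hlip : LipschitzOnWith (B * ‖A‖ * D + B * M + B * M).toNNReal w (uIcc 0 t) := by
    refine LipschitzOnWith.of_dist_le_mul fun a ha b hb => ?_
    rw [Real.coe_toNNReal _ (by positivity), dist_eq_norm, dist_eq_norm]
    have e : w a - w b = (Φ a - Φ b) (P a) + Φ b (P a - P b) - ∫ u in b..a, Φ u (f u) := by
      rw [← intervalIntegral.integral_interval_sub_left (hΦf 0 a) (hΦf 0 b)]
      simp only [hw, map_sub, sub_apply]
      abel
    have h1 : ‖(Φ a - Φ b) (P a)‖ ≤ B * ‖A‖ * ‖a - b‖ * D :=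
      ((Φ a - Φ b).le_opNorm _).trans
        (mul_le_mul (hΦlip a ha b hb) (hD a ha) (norm_nonneg _) (by positivity))
    have h2 : ‖Φ b (P a - P b)‖ ≤ B * (M * ‖a - b‖) :=
      ((Φ b).le_opNorm _).trans (mul_le_mul (hB b hb) (hPlip a b) (norm_nonneg _) hB0)
    have h3 : ‖∫ u in b..a, Φ u (f u)‖ ≤ B * M * ‖a - b‖ :=
      intervalIntegral.norm_integral_le_of_norm_le_const fun v hv =>
        ((Φ v).le_opNorm _).trans (mul_le_mul
          (hB v (uIcc_subset_uIcc hb ha (uIoc_subset_uIcc hv))) (hfM v) (norm_nonneg _) hB0)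
    rw [e]
    refine (norm_sub_le _ _).trans ((add_le_add_left (norm_add_le _ _) _).trans ?_)
    nlinarith
  have hder : ∀ᵐ s, s ∈ uIcc 0 t → HasDerivAt w 0 s := by
    filter_upwards [(hh 0 t).ae_hasDerivAt_integral, (hΦf 0 t).ae_hasDerivAt_integral]
      with s h1 h2 hs
    have h3 := ((hΦd s).clm_apply ((h1 hs 0 left_mem_uIcc).const_add p₀)).sub
      (h2 hs 0 left_mem_uIcc)
    have hs0 : 0 ≤ s := by
      rw [uIcc_of_le ht] at hs
      exact hs.1
    refine h3.congr_deriv ?_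
    rw [heq s hs0]
    simp only [_root_.neg_apply, mul_apply_eq_comp, map_add]
    abel
  obtain ⟨c, hc⟩ := hlip.absolutelyContinuousOnInterval.const_of_ae_hasDerivAt_zero hder
  have h0 := hc 0 left_mem_uIcc
  have h1 := hc t right_mem_uIcc
  rw [← h0] at h1
  have e0 : w 0 = NormedSpace.exp (t • A) p₀ := by simp [hw, hP, hΦ]
  have e1 : w t = P t - ∫ u in (0 : ℝ)..t, Φ u (f u) := by simp [hw, hΦ]
  have e2 : ∫ u in (0 : ℝ)..t, Φ u (f u)
      = ∫ s in (0 : ℝ)..t, NormedSpace.exp (s • A) (f (t - s)) := by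
    have := intervalIntegral.integral_comp_sub_left
      (fun s => NormedSpace.exp (s • A) (f (t - s))) t (a := 0) (b := t)
    simpa [hΦ] using this
  rw [e0, e1, e2] at h1
  exact sub_eq_iff_eq_add.1 h1

lemma exp_add_smul_apply [CompleteSpace E] (A : E →L[ℝ] E) (s t : ℝ) (v : E) :
    NormedSpace.exp ((s + t) • A) v = NormedSpace.exp (s • A) (NormedSpace.exp (t • A) v) := by
  let _ : NormedAlgebra ℚ (E →L[ℝ] E) := NormedAlgebra.restrictScalars ℚ ℝ (E →L[ℝ] E)
  rw [add_smul, NormedSpace.exp_add_of_commute ((Commute.refl A).smul_left s |>.smul_right t)]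
  rfl

lemma continuous_exp_smul [CompleteSpace E] (A : E →L[ℝ] E) : Continuous fun s : ℝ => NormedSpace.exp (s • A) :=
  continuous_iff_continuousAt.2 fun s => (hasDerivAt_exp_smul_const A s).continuousAt

end LinearODE

/-! ### The forward operator, uniqueness of solutions, conservation of mass -/

namespace MarkovChain

variable {X : Type*} [Fintype X]

/-- The operator of the forward equation `∂ₜ p(y) = ∑ x, (p(x) ρ(x, y) - p(y) ρ(y, x))`. -/
noncomputable def forwardGen (ρ : X → X → ℝ) : (X → ℝ) →L[ℝ] (X → ℝ) :=
  LinearMap.toContinuousLinearMap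
    { toFun := fun v y => ∑ x, (v x * ρ x y - v y * ρ y x)
      map_add' := fun v w => by
        funext y
        simp only [Pi.add_apply, ← Finset.sum_add_distrib]
        exact Finset.sum_congr rfl fun x _ => by ring
      map_smul' := fun c v => by
        funext y
        simp only [Pi.smul_apply, smul_eq_mul, RingHom.id_apply, Finset.mul_sum]
        exact Finset.sum_congr rfl fun x _ => by ring }

lemma forwardGen_apply (ρ : X → X → ℝ) (v : X → ℝ) (y : X) :
    forwardGen ρ v y = ∑ x, (v x * ρ x y - v y * ρ y x) := rfl

lemma sum_forwardGen (ρ : X → X → ℝ) (v : X → ℝ) : ∑ y, forwardGen ρ v y = 0 := by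
  simp only [forwardGen_apply, Finset.sum_sub_distrib]
  rw [Finset.sum_comm, sub_self]

/-- The entries `ρ` may have either sign, so that the estimate also applies to differences of rates,
of order λ or λ². -/
lemma norm_forwardGen_le {ρ : X → X → ℝ} {M : ℝ} (hM0 : 0 ≤ M) (hM : ∀ x y, |ρ x y| ≤ M)
    (v : X → ℝ) : ‖forwardGen ρ v‖ ≤ 2 * Fintype.card X * M * ‖v‖ := by
  refine (pi_norm_le_iff_of_nonneg (by positivity)).2 fun y => ?_
  rw [forwardGen_apply]
  refine (norm_sum_le _ _).trans ?_
  have h : ∀ x ∈ Finset.univ, ‖v x * ρ x y - v y * ρ y x‖ ≤ 2 * M * ‖v‖ := by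
    intro x _
    refine (norm_sub_le _ _).trans ?_
    rw [norm_mul, norm_mul]
    have h1 := mul_le_mul (norm_le_pi_norm v x) (hM x y) (abs_nonneg _) (norm_nonneg _)
    have h2 := mul_le_mul (norm_le_pi_norm v y) (hM y x) (abs_nonneg _) (norm_nonneg _)
    simp only [← Real.norm_eq_abs] at h1 h2
    linarith
  refine (Finset.sum_le_sum h).trans (le_of_eq ?_)
  simp
  ring

lemma forwardGen_add (ρ σ : X → X → ℝ) (v : X → ℝ) :
    forwardGen (fun x y => ρ x y + σ x y) v = forwardGen ρ v + forwardGen σ v := by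
  funext y
  simp only [forwardGen_apply, Pi.add_apply, ← Finset.sum_add_distrib]
  exact Finset.sum_congr rfl fun x _ => by ring

lemma forwardGen_smul (c : ℝ) (ρ : X → X → ℝ) (v : X → ℝ) :
    forwardGen (fun x y => c * ρ x y) v = c • forwardGen ρ v := by
  funext y
  simp only [forwardGen_apply, Pi.smul_apply, smul_eq_mul, Finset.mul_sum]
  exact Finset.sum_congr rfl fun x _ => by ring

lemma measurable_forwardGen {ρ : ℝ → X → X → ℝ} (hρ : ∀ x y, Measurable fun t => ρ t x y)
    {p : ℝ → X → ℝ} (hp : Measurable p) : Measurable fun t => forwardGen (ρ t) (p t) := by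
  refine measurable_pi_lambda _ fun y => ?_
  simp only [forwardGen_apply]
  exact Finset.measurable_sum _ fun x _ =>
    (((measurable_pi_iff.1 hp x).mul (hρ x y)).sub ((measurable_pi_iff.1 hp y).mul (hρ y x)))

end MarkovChain

namespace JumpRates

open MarkovChain

variable {X : Type*} [Fintype X]

lemma exists_norm_forwardGen_le (R : JumpRates X) :
    ∃ C : ℝ, 0 ≤ C ∧ ∀ t v, ‖forwardGen (R.rate t) v‖ ≤ C * ‖v‖ := by
  obtain ⟨C, hC⟩ := R.rate_bounded
  refine ⟨2 * Fintype.card X * |C|, by positivity, fun t v =>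
    norm_forwardGen_le (abs_nonneg C) (fun x y => ?_) v⟩
  rw [abs_of_nonneg (R.rate_nonneg t x y)]
  exact (hC t x y).trans (le_abs_self C)

/-- Bounded measurable solutions of the integrated forward equation on `[0, ∞)`. -/
structure IsForwardSolution (R : JumpRates X) (p : ℝ → X → ℝ) : Prop where
  measurable : Measurable p
  bounded : ∃ C : ℝ, ∀ t, ‖p t‖ ≤ C
  eq_add_integral : ∀ t, 0 ≤ t → p t = p 0 + ∫ u in (0 : ℝ)..t, forwardGen (R.rate u) (p u)

namespace IsForwardSolution

variable {R : JumpRates X} {p q : ℝ → X → ℝ}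

lemma exists_norm_le (hp : R.IsForwardSolution p) :
    ∃ C : ℝ, ∀ t, ‖forwardGen (R.rate t) (p t)‖ ≤ C := by
  obtain ⟨C, hC0, hC⟩ := R.exists_norm_forwardGen_le
  obtain ⟨D, hD⟩ := hp.bounded
  exact ⟨C * D, fun t => (hC t _).trans (mul_le_mul_of_nonneg_left (hD t) hC0)⟩

lemma intervalIntegrable (hp : R.IsForwardSolution p) (a b : ℝ) :
    IntervalIntegrable (fun u => forwardGen (R.rate u) (p u)) volume a b := by
  obtain ⟨C, hC⟩ := hp.exists_norm_le
  exact LinearODE.intervalIntegrable_of_norm_le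
    (measurable_forwardGen R.measurable_rate hp.measurable).aestronglyMeasurable hC a b

lemma sub (hp : R.IsForwardSolution p) (hq : R.IsForwardSolution q) :
    R.IsForwardSolution fun t => p t - q t := by
  refine ⟨hp.measurable.sub hq.measurable, ?_, fun t ht => ?_⟩
  · obtain ⟨C, hC⟩ := hp.bounded
    obtain ⟨D, hD⟩ := hq.bounded
    exact ⟨C + D, fun t => (norm_sub_le _ _).trans (add_le_add (hC t) (hD t))⟩
  · simp only [map_sub]
    rw [intervalIntegral.integral_sub (hp.intervalIntegrable _ _) (hq.intervalIntegrable _ _),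
      hp.eq_add_integral t ht, hq.eq_add_integral t ht]
    abel

lemma sum_smul {ι : Type*} (s : Finset ι) (c : ι → ℝ) {p : ι → ℝ → X → ℝ}
    (hp : ∀ i ∈ s, R.IsForwardSolution (p i)) :
    R.IsForwardSolution fun t => ∑ i ∈ s, c i • p i t := by
  refine ⟨?_, ?_, fun t ht => ?_⟩
  · exact Finset.measurable_sum _ fun i hi => (hp i hi).measurable.const_smul (c i)
  · choose! C hC using fun i hi => (hp i hi).bounded
    refine ⟨∑ i ∈ s, ‖c i‖ * C i, fun t => (norm_sum_le _ _).trans (Finset.sum_le_sum ?_)⟩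
    intro i hi
    rw [norm_smul]
    exact mul_le_mul_of_nonneg_left (hC i hi t) (norm_nonneg _)
  · simp only [map_sum, map_smul]
    rw [intervalIntegral.integral_finsetSum
        (f := fun i u => c i • forwardGen (R.rate u) (p i u)) fun i hi =>
        ((hp i hi).intervalIntegrable 0 t).smul (c i),
      ← Finset.sum_add_distrib]
    refine Finset.sum_congr rfl fun i hi => ?_
    rw [intervalIntegral.integral_smul, ← smul_add, ← (hp i hi).eq_add_integral t ht]

/-- Uniqueness by Grönwall: with zero initial value the solution is the integral of its own
derivative, which it bounds linearly. -/
lemma eq_zero (hp : R.IsForwardSolution p) (h0 : p 0 = 0) {t : ℝ} (ht : 0 ≤ t) : p t = 0 := by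
  obtain ⟨C, hC0, hC⟩ := R.exists_norm_forwardGen_le
  have h : ∀ u, 0 ≤ u → p u = ∫ v in (0 : ℝ)..u, forwardGen (R.rate v) (p v) := fun u hu => by
    rw [hp.eq_add_integral u hu, h0, zero_add]
  rw [h t ht]
  exact LinearODE.intervalIntegral_eq_zero_of_norm_le hp.intervalIntegrable
    (fun u hu => by rw [← h u hu]; exact hC u _) ht

lemma eq_of_zero_eq (hp : R.IsForwardSolution p) (hq : R.IsForwardSolution q) (h0 : p 0 = q 0)
    {t : ℝ} (ht : 0 ≤ t) : p t = q t :=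
  sub_eq_zero.1 ((hp.sub hq).eq_zero (sub_eq_zero.2 h0) ht)

lemma comp_add_period (hp : R.IsForwardSolution p) {T : ℝ} (hT : 0 ≤ T)
    (hR : ∀ t, R.rate (t + T) = R.rate t) : R.IsForwardSolution fun t => p (t + T) := by
  refine ⟨hp.measurable.comp (measurable_id.add_const T), ?_, fun t ht => ?_⟩
  · obtain ⟨C, hC⟩ := hp.bounded
    exact ⟨C, fun t => hC _⟩
  · have h := intervalIntegral.integral_comp_add_right
      (fun u => forwardGen (R.rate u) (p u)) T (a := 0) (b := t)
    simp only [hR] at h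
    rw [h, hp.eq_add_integral (t + T) (by positivity), zero_add, hp.eq_add_integral T hT, add_assoc,
      intervalIntegral.integral_add_adjacent_intervals (hp.intervalIntegrable _ _)
        (hp.intervalIntegrable _ _)]

lemma sum_eq (hp : R.IsForwardSolution p) {t : ℝ} (ht : 0 ≤ t) : ∑ y, p t y = ∑ y, p 0 y := by
  let S : (X → ℝ) →L[ℝ] ℝ := ∑ y, ContinuousLinearMap.proj y
  have hS : ∀ v, S v = ∑ y, v y := fun v => by simp [S]
  have h := congrArg S (hp.eq_add_integral t ht)
  rw [map_add, ← ContinuousLinearMap.intervalIntegral_comp_comm S (hp.intervalIntegrable 0 t)] at h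
  simpa [hS, sum_forwardGen] using h

end IsForwardSolution

variable [MeasurableSpace X] [MeasurableSingletonClass X]

lemma isForwardSolution_marginal (R : JumpRates X) {ν : X → ℝ} (hν : ν ∈ stdSimplex ℝ X) :
    R.IsForwardSolution (R.marginal ν) ∧ R.marginal ν 0 = ν := by
  have hm : Measurable (R.marginal ν) := measurable_pi_iff.2 fun x => R.measurable_marginal hν x
  have hb : ∀ t, ‖R.marginal ν t‖ ≤ 1 := fun t =>
    (pi_norm_le_iff_of_nonneg zero_le_one).2 fun x => by
      rw [Real.norm_of_nonneg (R.marginal_nonneg ν t x)]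
      exact R.marginal_le_one hν t x
  obtain ⟨C, hC0, hC⟩ := R.exists_norm_forwardGen_le
  obtain ⟨M, hM⟩ := R.rate_bounded
  have hint : ∀ x y a b, IntervalIntegrable (fun u => R.marginal ν u x * R.rate u x y)
      volume a b := by
    intro x y a b
    refine LinearODE.intervalIntegrable_of_norm_le (C := M)
      ((R.measurable_marginal hν x).mul (R.measurable_rate x y)).aestronglyMeasurable
      (fun u => ?_) a b
    rw [Pi.mul_apply, norm_mul, Real.norm_of_nonneg (R.marginal_nonneg ν u x),
      Real.norm_of_nonneg (R.rate_nonneg u x y)]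
    have := R.marginal_le_one hν u x
    have := R.rate_nonneg u x y
    nlinarith [hM u x y]
  have heq : ∀ t, 0 ≤ t →
      R.marginal ν t = ν + ∫ u in (0 : ℝ)..t, forwardGen (R.rate u) (R.marginal ν u) := by
    intro t ht
    funext y
    have hi := LinearODE.intervalIntegrable_of_norm_le (f := fun u =>
      forwardGen (R.rate u) (R.marginal ν u)) (C := C)
      (measurable_forwardGen R.measurable_rate hm).aestronglyMeasurable
      (fun u => (hC u _).trans (mul_le_of_le_one_right hC0 (hb u))) 0 t
    have h := ContinuousLinearMap.intervalIntegral_comp_comm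
      (ContinuousLinearMap.proj (R := ℝ) (φ := fun _ : X => ℝ) y) hi
    simp only [ContinuousLinearMap.proj_apply, forwardGen_apply] at h
    rw [Pi.add_apply, ← h, intervalIntegral.integral_finsetSum fun x _ =>
      (hint x y _ _).sub (hint y x _ _)]
    simp_rw [intervalIntegral.integral_sub (hint _ y _ _) (hint y _ _ _)]
    rw [Finset.sum_sub_distrib]
    linarith [R.marginal_forward hν ht y]
  have h0 : R.marginal ν 0 = ν := by simpa using heq 0 le_rfl
  exact ⟨⟨hm, ⟨1, hb⟩, fun t ht => by rw [h0]; exact heq t ht⟩, h0⟩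

/-- This is non-explosion: the forward operator conserves mass, so none is lost to the cemetery
state `none`. -/
lemma marginal_mem_stdSimplex (R : JumpRates X) {ν : X → ℝ} (hν : ν ∈ stdSimplex ℝ X) {t : ℝ}
    (ht : 0 ≤ t) : R.marginal ν t ∈ stdSimplex ℝ X := by
  obtain ⟨h, h0⟩ := R.isForwardSolution_marginal hν
  refine ⟨fun x => R.marginal_nonneg ν t x, ?_⟩
  rw [h.sum_eq ht, h0, hν.2]

/-- The processes started from point masses form a fundamental system; linearity and uniqueness do
the rest. -/
lemma eq_sum_marginal (R : JumpRates X) [DecidableEq X] {p : ℝ → X → ℝ}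
    (hp : R.IsForwardSolution p) {t : ℝ} (ht : 0 ≤ t) :
    p t = ∑ x, p 0 x • R.marginal (Pi.single x 1) t := by
  have h := fun x => R.isForwardSolution_marginal (single_mem_stdSimplex ℝ x)
  refine hp.eq_of_zero_eq (.sum_smul _ _ fun x _ => (h x).1) ?_ ht
  simp only [(h _).2]
  exact pi_eq_sum_univ' _

end JumpRates

/-! ### Positivity, Dobrushin contraction and invariant distributions -/

namespace LinearODE

lemma exp_smul_one_apply (c s z : ℝ) :
    NormedSpace.exp (s • (c • (1 : ℝ →L[ℝ] ℝ))) z = Real.exp (s * c) * z := by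
  have h := NormedSpace.algebraMap_exp_comm (𝕂 := ℝ) (𝔸 := ℝ →L[ℝ] ℝ) (s * c)
  rw [smul_smul, ← Algebra.algebraMap_eq_smul_one, ← h, Algebra.algebraMap_eq_smul_one,
    ← Real.exp_eq_exp_ℝ]
  rfl

/-- A bounded nonnegative solution of `m' = h`, `h ≥ k - C m`, is positive if it starts from a
positive value or `k` is positive. -/
lemma pos_of_forward {m h k : ℝ → ℝ} {m₀ C : ℝ} (hh : Measurable h) (hm : Measurable m)
    {M : ℝ} (hhM : ∀ u, ‖h u‖ ≤ M) (hmM : ∀ u, ‖m u‖ ≤ M) (hk : Measurable k)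
    (hkM : ∀ u, ‖k u‖ ≤ M)
    (heq : ∀ u, 0 ≤ u → m u = m₀ + ∫ v in (0 : ℝ)..u, h v) (hm₀ : 0 ≤ m₀)
    (hle : ∀ u, k u ≤ h u + C * m u) (hk0 : ∀ u, 0 ≤ k u) {t : ℝ} (ht : 0 < t)
    (hpos : 0 < m₀ ∨ ∀ u, 0 < u → u ≤ t → 0 < k u) : 0 < m t := by
  have hM : 0 ≤ M := (norm_nonneg _).trans (hhM 0)
  -- This reads the equation as m' = -C m + f with f ≥ k ≥ 0; variation of constants then bounds
  -- m(t) below by e^{-Ct} m₀ plus the integral of e^{-Cs} k(t - s).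
  set f : ℝ → ℝ := fun u => h u + C * m u with hf
  have hfM : ∀ u, ‖f u‖ ≤ M + |C| * M := fun u => by
    refine (norm_add_le _ _).trans (add_le_add (hhM u) ?_)
    rw [norm_mul]
    exact mul_le_mul_of_nonneg_left (hmM u) (abs_nonneg _)
  have hfm : Measurable f := hh.add (hm.const_mul C)
  have key := duhamel ((-C) • (1 : ℝ →L[ℝ] ℝ)) (h := h) (f := f) (p₀ := m₀)
    (fun a b => intervalIntegrable_of_norm_le hh.aestronglyMeasurable hhM a b)
    (fun a b => intervalIntegrable_of_norm_le hfm.aestronglyMeasurable hfM a b)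
    (M := M + |C| * M) (fun u => (hhM u).trans (le_add_of_nonneg_right (by positivity))) hfM ht.le
    (fun u hu => by
      rw [← heq u hu]
      simp [hf])
  rw [← heq t ht.le] at key
  simp only [exp_smul_one_apply] at key
  have hexp : Continuous fun s => Real.exp (s * -C) := by fun_prop
  have hii : ∀ {q : ℝ → ℝ} {D : ℝ}, Measurable q → (∀ u, ‖q u‖ ≤ D) →
      IntervalIntegrable (fun s => Real.exp (s * -C) * q (t - s)) volume 0 t := by
    intro q D hq hD
    exact (intervalIntegrable_of_norm_le (hq.comp (measurable_const.sub measurable_id)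
      ).aestronglyMeasurable (fun u => hD _) 0 t).continuousOn_mul hexp.continuousOn
  have hmono : ∫ s in (0 : ℝ)..t, Real.exp (s * -C) * k (t - s)
      ≤ ∫ s in (0 : ℝ)..t, Real.exp (s * -C) * f (t - s) :=
    intervalIntegral.integral_mono_on ht.le (hii hk hkM) (hii hfm hfM) fun s _ =>
      mul_le_mul_of_nonneg_left (hle _) (Real.exp_pos _).le
  have hk0' : 0 ≤ ∫ s in (0 : ℝ)..t, Real.exp (s * -C) * k (t - s) :=
    intervalIntegral.integral_nonneg ht.le fun s _ => mul_nonneg (Real.exp_pos _).le (hk0 _)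
  have he := Real.exp_pos (t * -C)
  rcases hpos with hp | hp
  · have := mul_pos he hp
    linarith
  · have h1 : 0 < ∫ s in (0 : ℝ)..t, Real.exp (s * -C) * k (t - s) :=
      intervalIntegral.intervalIntegral_pos_of_pos_on (hii hk hkM) (fun s hs =>
        mul_pos (Real.exp_pos _) (hp _ (by linarith [hs.2]) (by linarith [hs.1]))) ht
    have := mul_nonneg he.le hm₀
    linarith

end LinearODE

namespace MarkovChain

variable {X : Type*} [Fintype X]

/-- Dobrushin's contraction estimate for a stochastic matrix with entries bounded below. -/
lemma sum_abs_le_of_le {P : X → X → ℝ} {δ : ℝ} (hδ : ∀ x y, δ ≤ P x y)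
    (hP : ∀ x, ∑ y, P x y = 1) {v : X → ℝ} (hv : ∑ x, v x = 0) :
    ∑ y, |∑ x, v x * P x y| ≤ (1 - Fintype.card X * δ) * ∑ x, |v x| := by
  -- Since `v` has total mass zero, the constant `δ` can be subtracted from every entry without
  -- changing the sums.
  calc ∑ y, |∑ x, v x * P x y| = ∑ y, |∑ x, v x * (P x y - δ)| := by
        refine Finset.sum_congr rfl fun y _ => ?_
        simp only [mul_sub, Finset.sum_sub_distrib, ← Finset.sum_mul, hv, zero_mul, sub_zero]
    _ ≤ ∑ y, ∑ x, |v x| * (P x y - δ) := by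
        refine Finset.sum_le_sum fun y _ => (Finset.abs_sum_le_sum_abs _ _).trans
          (Finset.sum_le_sum fun x _ => ?_)
        rw [abs_mul, abs_of_nonneg (sub_nonneg.2 (hδ x y))]
    _ = (1 - Fintype.card X * δ) * ∑ x, |v x| := by
        rw [Finset.sum_comm, Finset.mul_sum]
        refine Finset.sum_congr rfl fun x _ => ?_
        rw [← Finset.mul_sum, Finset.sum_sub_distrib, hP]
        simp [mul_comm]

variable [Nonempty X]

/-- A stochastic matrix with positive entries contracts strictly on vectors of total mass zero. -/
lemma exists_contraction {P : X → X → ℝ} (hpos : ∀ x y, 0 < P x y) (hP : ∀ x, ∑ y, P x y = 1) :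
    ∃ c : ℝ, 0 < c ∧ c < 1 ∧ ∀ v : X → ℝ, ∑ x, v x = 0 →
      ∑ y, |∑ x, v x * P x y| ≤ c * ∑ x, |v x| := by
  obtain ⟨z, hz⟩ := Finite.exists_min fun z : X × X => P z.1 z.2
  have hcard : (0 : ℝ) < Fintype.card X := by exact_mod_cast Fintype.card_pos
  have hδ : ∀ x y, P z.1 z.2 ≤ P x y := fun x y => hz (x, y)
  -- Half the smallest entry: the rows sum to one, so the contraction constant is at least 1/2. Its
  -- positivity is needed when its logarithm becomes the decay rate.
  set δ := P z.1 z.2 / 2 with hδ2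
  have hδ0 : 0 < δ := half_pos (hpos _ _)
  refine ⟨1 - Fintype.card X * δ, ?_, ?_, fun v hv =>
    sum_abs_le_of_le (fun x y => (half_le_self (hpos _ _).le).trans (hδ x y)) hP hv⟩
  · have h1 : ∑ _y : X, P z.1 z.2 ≤ ∑ y, P z.1 y := Finset.sum_le_sum fun y _ => hδ z.1 y
    rw [hP, Finset.sum_const, Finset.card_univ, nsmul_eq_mul] at h1
    rw [hδ2]
    linarith
  · have := mul_pos hcard hδ0
    linarith

/-- The displacement ∑ |Lν - ν| attains its minimum on the compact simplex. Applying `L` to a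
minimiser would shrink the displacement by the factor `c < 1`, so the minimum is zero. The
contraction also gives uniqueness. -/
lemma existsUnique_invariant {P : X → X → ℝ} (hpos : ∀ x y, 0 < P x y)
    (hP : ∀ x, ∑ y, P x y = 1) :
    ∃! ν : X → ℝ, ν ∈ stdSimplex ℝ X ∧ (fun y => ∑ x, ν x * P x y) = ν := by
  classical
  obtain ⟨c, hc0, hc1, hc⟩ := exists_contraction hpos hP
  set L : (X → ℝ) → X → ℝ := fun ν y => ∑ x, ν x * P x y with hL
  have hLc : Continuous L := by fun_prop
  have hLmem : ∀ ν ∈ stdSimplex ℝ X, L ν ∈ stdSimplex ℝ X := by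
    intro ν hν
    refine ⟨fun y => Finset.sum_nonneg fun x _ => mul_nonneg (hν.1 x) (hpos x y).le, ?_⟩
    simp only [hL]
    rw [Finset.sum_comm]
    simp only [← Finset.mul_sum, hP, mul_one]
    exact hν.2
  have hcontr : ∀ ν ∈ stdSimplex ℝ X, ∀ μ ∈ stdSimplex ℝ X,
      ∑ y, |L ν y - L μ y| ≤ c * ∑ x, |ν x - μ x| := by
    intro ν hν μ hμ
    have h := hc (fun x => ν x - μ x) (by rw [Finset.sum_sub_distrib, hν.2, hμ.2, sub_self])
    simpa only [hL, sub_mul, Finset.sum_sub_distrib] using h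
  have hzero : ∀ v : X → ℝ, ∑ x, |v x| ≤ c * ∑ x, |v x| → ∀ x, v x = 0 := by
    intro v hv x
    have h0 : 0 ≤ ∑ x, |v x| := Finset.sum_nonneg fun x _ => abs_nonneg _
    have h1 : ∑ x, |v x| = 0 := by nlinarith
    exact abs_eq_zero.1 ((Finset.sum_eq_zero_iff_of_nonneg fun x _ => abs_nonneg _).1 h1 x
      (Finset.mem_univ x))
  have hne : (stdSimplex ℝ X).Nonempty := ⟨_, single_mem_stdSimplex ℝ (Classical.arbitrary X)⟩
  have hFc : Continuous fun ν : X → ℝ => ∑ y, |L ν y - ν y| := by fun_prop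
  obtain ⟨ν, hν, hmin⟩ := (isCompact_stdSimplex ℝ X).exists_isMinOn hne hFc.continuousOn
  refine ⟨ν, ⟨hν, ?_⟩, ?_⟩
  · funext y
    refine sub_eq_zero.1 (hzero (fun y => L ν y - ν y) ?_ y)
    exact (isMinOn_iff.1 hmin _ (hLmem ν hν)).trans (hcontr _ (hLmem ν hν) _ hν)
  · rintro μ ⟨hμ, hμL⟩
    funext y
    refine sub_eq_zero.1 (hzero (fun y => μ y - ν y) ?_ y)
    have hνL : L ν = ν := by
      funext y
      refine sub_eq_zero.1 (hzero (fun y => L ν y - ν y) ?_ y)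
      exact (isMinOn_iff.1 hmin _ (hLmem ν hν)).trans (hcontr _ (hLmem ν hν) _ hν)
    have h := hcontr μ hμ ν hν
    rwa [hνL, show L μ = μ from hμL] at h

end MarkovChain

namespace JumpRates

open MarkovChain

variable {X : Type*} [Fintype X] [MeasurableSpace X] [MeasurableSingletonClass X]

lemma marginal_apply_eq (R : JumpRates X) {ν : X → ℝ} (hν : ν ∈ stdSimplex ℝ X) {t : ℝ}
    (ht : 0 ≤ t) (y : X) :
    R.marginal ν t y = ν y + ∫ u in (0 : ℝ)..t, forwardGen (R.rate u) (R.marginal ν u) y := by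
  obtain ⟨h, h0⟩ := R.isForwardSolution_marginal hν
  have h1 := congrFun (h.eq_add_integral t ht) y
  have h2 := ContinuousLinearMap.intervalIntegral_comp_comm
    (ContinuousLinearMap.proj (R := ℝ) (φ := fun _ : X => ℝ) y) (h.intervalIntegrable 0 t)
  rw [h1, Pi.add_apply, h0]
  simp only [ContinuousLinearMap.proj_apply] at h2
  rw [h2]

/-- `pos_of_forward` is used with `k` the inflow into `y` and `C` a bound on the exit rates: either
initial mass at `y` survives, or a positive inflow from `x` creates some. -/
lemma marginal_pos_of_pos (R : JumpRates X) {ν : X → ℝ} (hν : ν ∈ stdSimplex ℝ X) {t : ℝ}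
    (ht : 0 < t) {y : X}
    (hy : 0 < ν y ∨ ∃ x, (∀ u, 0 < R.rate u x y) ∧ ∀ u, 0 < u → 0 < R.marginal ν u x) :
    0 < R.marginal ν t y := by
  obtain ⟨h, h0⟩ := R.isForwardSolution_marginal hν
  obtain ⟨C, hC⟩ := R.exitRate_bounded
  obtain ⟨B, hB⟩ := h.exists_norm_le
  have hm := fun x => R.measurable_marginal hν x
  set k : ℝ → ℝ := fun u => ∑ x, R.marginal ν u x * R.rate u x y with hk
  have hterm : ∀ u x, 0 ≤ R.marginal ν u x * R.rate u x y := fun u x =>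
    mul_nonneg (R.marginal_nonneg ν u x) (R.rate_nonneg u x y)
  have hgen : ∀ u, forwardGen (R.rate u) (R.marginal ν u) y
      = k u - R.exitRate u y * R.marginal ν u y := by
    intro u
    rw [forwardGen_apply, Finset.sum_sub_distrib, exitRate, Finset.sum_mul]
    simp only [hk, mul_comm]
  have hkm : Measurable k := Finset.measurable_sum _ fun x _ => (hm x).mul (R.measurable_rate x y)
  have hm1 : ∀ u, ‖R.marginal ν u y‖ ≤ 1 := fun u => by
    rw [Real.norm_of_nonneg (R.marginal_nonneg ν u y)]
    exact R.marginal_le_one hν u y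
  have hB' : ∀ u, ‖forwardGen (R.rate u) (R.marginal ν u) y‖ ≤ B := fun u =>
    (norm_le_pi_norm _ y).trans (hB u)
  have hC0 : 0 ≤ C := (norm_nonneg _).trans (hC 0 y)
  have hB0 : 0 ≤ B := (norm_nonneg _).trans (hB' 0)
  refine LinearODE.pos_of_forward (h := fun u => forwardGen (R.rate u) (R.marginal ν u) y)
    (k := k) (m₀ := ν y) (C := C) (M := B + C + 1)
    (measurable_pi_iff.1 (measurable_forwardGen R.measurable_rate h.measurable) y) (hm y)
    (fun u => (hB' u).trans (by linarith)) (fun u => (hm1 u).trans (by linarith)) hkm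
    (fun u => ?_) (fun u hu => R.marginal_apply_eq hν hu y) (hν.1 y) (fun u => ?_)
    (fun u => Finset.sum_nonneg fun x _ => hterm u x) ht (hy.imp id ?_)
  · have h1 : k u = forwardGen (R.rate u) (R.marginal ν u) y
      + R.exitRate u y * R.marginal ν u y := by rw [hgen]; ring
    rw [h1]
    refine (norm_add_le _ _).trans ?_
    have h2 := mul_le_mul (hC u y) (hm1 u) (norm_nonneg _) hC0
    rw [norm_mul]
    linarith [hB' u]
  · have h1 := mul_le_mul_of_nonneg_right ((le_abs_self _).trans (hC u y))
      (R.marginal_nonneg ν u y)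
    simp only [hgen]
    linarith
  · rintro ⟨x, hx, hxm⟩ u hu -
    exact Finset.sum_pos' (fun x _ => hterm u x) ⟨x, Finset.mem_univ x, mul_pos (hxm u hu) (hx u)⟩

/-- Irreducibility: all states have positive probability at any positive time. -/
lemma marginal_pos (R : JumpRates X) (hR : ∀ x y,
    Relation.ReflTransGen (fun a b => ∀ u, 0 < R.rate u a b) x y) {ν : X → ℝ}
    (hν : ν ∈ stdSimplex ℝ X) {t : ℝ} (ht : 0 < t) (y : X) : 0 < R.marginal ν t y := by
  obtain ⟨x, hx⟩ : ∃ x, 0 < ν x := by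
    by_contra! hcon
    have := Finset.sum_nonpos fun x (_ : x ∈ Finset.univ) => hcon x
    rw [hν.2] at this
    linarith
  -- The induction along a path of positive rates needs positivity at all positive times, since the
  -- inflow into the next state is integrated over the past.
  have hall : ∀ u, 0 < u → 0 < R.marginal ν u y := by
    induction hR x y with
    | refl => exact fun u hu => R.marginal_pos_of_pos hν hu (Or.inl hx)
    | tail _ hab ih => exact fun u hu => R.marginal_pos_of_pos hν hu (Or.inr ⟨_, hab, ih⟩)
  exact hall t ht

end JumpRates

/-! ### The chain observed once per period -/

namespace JumpRates

open MarkovChain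

variable {X : Type*} [Fintype X] [MeasurableSpace X] [MeasurableSingletonClass X]

lemma marginal_add_period (R : JumpRates X) {ν : X → ℝ} (hν : ν ∈ stdSimplex ℝ X) {T : ℝ}
    (hT : 0 ≤ T) (hR : ∀ t, R.rate (t + T) = R.rate t) {t : ℝ} (ht : 0 ≤ t) :
    R.marginal ν (t + T) = R.marginal (R.marginal ν T) t := by
  obtain ⟨h, h0⟩ := R.isForwardSolution_marginal (R.marginal_mem_stdSimplex hν hT)
  refine (R.isForwardSolution_marginal hν).1.comp_add_period hT hR |>.eq_of_zero_eq h ?_ ht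
  rw [h0, zero_add]

variable [Nonempty X]

/-- Over one period the marginal depends on the initial law through the matrix of transition
probabilities from point masses, which is stochastic with positive entries. -/
lemma existsUnique_isPeriodicInvariant (R : JumpRates X) (hR : ∀ x y,
    Relation.ReflTransGen (fun a b => ∀ u, 0 < R.rate u a b) x y) {T : ℝ} (hT : 0 < T) :
    ∃! ν : X → ℝ, R.IsPeriodicInvariant T ν := by
  classical
  have h := existsUnique_invariant (P := fun x y => R.marginal (Pi.single x 1) T y)
    (fun x y => R.marginal_pos hR (single_mem_stdSimplex ℝ x) hT y)
    (fun x => (R.marginal_mem_stdSimplex (single_mem_stdSimplex ℝ x) hT.le).2)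
  have hiff : ∀ ν : X → ℝ, ν ∈ stdSimplex ℝ X →
      R.marginal ν T = fun y => ∑ x, ν x * R.marginal (Pi.single x 1) T y := by
    intro ν hν
    obtain ⟨h1, h0⟩ := R.isForwardSolution_marginal hν
    funext y
    rw [R.eq_sum_marginal h1 hT.le, h0]
    simp
  refine (existsUnique_congr fun ν => ?_).1 h
  exact and_congr_right fun hν => by rw [hiff ν hν]

end JumpRates

/-! ### Exponential ergodicity and the convolution formula for the OSS -/

namespace MarkovChain

variable {X : Type*} [Fintype X] {r : X → X → ℝ} {hr : ∀ x y, 0 ≤ r x y}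
  {hpos : ∀ x, 0 < ∑ y, r x y}

lemma unperturbed_reflTransGen (hirr : IsIrreducible r) (x y : X) :
    Relation.ReflTransGen (fun a b => ∀ u, 0 < (unperturbed r hr hpos).rate u a b) x y :=
  Relation.ReflTransGen.mono (fun _ _ h _ => h) _ _ (hirr x y)

lemma exp_forwardGen_eq {p : ℝ → X → ℝ} (hp : (unperturbed r hr hpos).IsForwardSolution p) {t : ℝ}
    (ht : 0 ≤ t) : NormedSpace.exp (t • forwardGen r) (p 0) = p t := by
  obtain ⟨C, hC⟩ := hp.exists_norm_le
  have h := LinearODE.duhamel (forwardGen r) (h := fun u => forwardGen r (p u)) (f := 0)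
    (p₀ := p 0) hp.intervalIntegrable (fun a b => intervalIntegrable_const) hC
    (fun u => by simpa using (norm_nonneg _).trans (hC 0)) ht
    (fun u hu => by
      rw [hp.eq_add_integral u hu]
      simp [unperturbed])
  have h2 := hp.eq_add_integral t ht
  simp only [unperturbed] at h2
  rw [h2, h]
  simp

lemma norm_le_one_of_mem_stdSimplex {p : X → ℝ} (hp : p ∈ stdSimplex ℝ X) : ‖p‖ ≤ 1 :=
  (pi_norm_le_iff_of_nonneg zero_le_one).2 fun x => by
    rw [Real.norm_of_nonneg (hp.1 x), ← hp.2]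
    exact Finset.single_le_sum (fun x _ => hp.1 x) (Finset.mem_univ x)

variable [MeasurableSpace X] [MeasurableSingletonClass X]

/-- The entries of the matrix exponential are transition probabilities of the process, which is how
positivity and stochasticity reach the semigroup. -/
lemma exp_forwardGen_apply [DecidableEq X] (hr : ∀ x y, 0 ≤ r x y) (hpos : ∀ x, 0 < ∑ y, r x y)
    (v : X → ℝ) {t : ℝ} (ht : 0 ≤ t) (y : X) :
    NormedSpace.exp (t • forwardGen r) v y
      = ∑ x, v x * (unperturbed r hr hpos).marginal (Pi.single x 1) t y := by
  have h : ∀ x : X, NormedSpace.exp (t • forwardGen r) (Pi.single x 1)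
      = (unperturbed r hr hpos).marginal (Pi.single x 1) t := by
    intro x
    obtain ⟨h1, h0⟩ := (unperturbed r hr hpos).isForwardSolution_marginal
      (single_mem_stdSimplex ℝ x)
    rw [← exp_forwardGen_eq h1 ht, h0]
  conv_lhs => rw [pi_eq_sum_univ' v]
  simp only [map_sum, map_smul, Finset.sum_apply, Pi.smul_apply, smul_eq_mul, h]

lemma forwardGen_eq_zero_of_isInvariant {π : X → ℝ}
    (h : (unperturbed r hr hpos).IsInvariant π) : forwardGen r π = 0 := by
  funext y
  have h1 := (unperturbed r hr hpos).marginal_apply_eq h.1 zero_le_one y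
  have h2 : ∫ u in (0 : ℝ)..1, forwardGen ((unperturbed r hr hpos).rate u)
      ((unperturbed r hr hpos).marginal π u) y = ∫ u in (0 : ℝ)..1, forwardGen r π y := by
    refine intervalIntegral.integral_congr fun u hu => ?_
    rw [uIcc_of_le zero_le_one] at hu
    simp only [h.2 u hu.1]
    rfl
  rw [h.2 1 zero_le_one, h2] at h1
  simpa using h1

variable [Nonempty X]

/-- Exponential ergodicity. -/
lemma exists_norm_exp_forwardGen_le (hr : ∀ x y, 0 ≤ r x y) (hpos : ∀ x, 0 < ∑ y, r x y)
    (hirr : IsIrreducible r) :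
    ∃ K b : ℝ, 0 ≤ K ∧ 0 < b ∧ ∀ s, 0 ≤ s → ∀ v : X → ℝ, ∑ x, v x = 0 →
      ‖NormedSpace.exp (s • forwardGen r) v‖ ≤ K * Real.exp (-b * s) * ‖v‖ := by
  classical
  set P : ℝ → X → X → ℝ := fun t x => (unperturbed r hr hpos).marginal (Pi.single x 1) t with hP
  have hPs : ∀ t, 0 ≤ t → ∀ x, P t x ∈ stdSimplex ℝ X := fun t ht x =>
    (unperturbed r hr hpos).marginal_mem_stdSimplex (single_mem_stdSimplex ℝ x) ht
  obtain ⟨c, hc0, hc1, hc⟩ := exists_contraction (P := P 1) (fun x y =>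
    (unperturbed r hr hpos).marginal_pos (unperturbed_reflTransGen hirr)
      (single_mem_stdSimplex ℝ x) one_pos y) (fun x => (hPs 1 zero_le_one x).2)
  set Φ : ℝ → (X → ℝ) →L[ℝ] (X → ℝ) := fun t => NormedSpace.exp (t • forwardGen r) with hΦ
  have hΦP : ∀ t, 0 ≤ t → ∀ v y, Φ t v y = ∑ x, v x * P t x y := fun t ht v y =>
    exp_forwardGen_apply hr hpos v ht y
  have hsum : ∀ t, 0 ≤ t → ∀ v : X → ℝ, ∑ x, v x = 0 → ∑ y, Φ t v y = 0 := by
    intro t ht v hv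
    simp only [hΦP t ht]
    rw [Finset.sum_comm]
    simp only [← Finset.mul_sum, (hPs t ht _).2, mul_one, hv]
  have hle : ∀ t, 0 ≤ t → ∀ v : X → ℝ, ∑ x, v x = 0 → ∑ y, |Φ t v y| ≤ ∑ x, |v x| := by
    intro t ht v hv
    simp only [hΦP t ht]
    simpa using sum_abs_le_of_le (P := P t) (fun x y => (hPs t ht x).1 y)
      (fun x => (hPs t ht x).2) hv
  have hpow : ∀ n : ℕ, ∀ v : X → ℝ, ∑ x, v x = 0 → ∑ y, |Φ n v y| ≤ c ^ n * ∑ x, |v x| := by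
    intro n
    induction n with
    | zero => intro v hv; simp [hΦ]
    | succ n ih =>
      intro v hv
      have h1 : Φ ((n + 1 : ℕ) : ℝ) v = Φ 1 (Φ n v) := by
        rw [Nat.cast_succ, add_comm]
        exact LinearODE.exp_add_smul_apply _ _ _ _
      rw [h1, pow_succ', mul_assoc]
      simp only [hΦP 1 zero_le_one]
      exact (hc _ (hsum n n.cast_nonneg v hv)).trans (mul_le_mul_of_nonneg_left (ih v hv) hc0.le)
  -- Whole time units contract by `c` each and the fractional rest does not expand. The factor `c⁻¹`
  -- pays for c^⌊s⌋ ≤ c^(s-1), the cardinality for passing from the ℓ¹ norm to the sup norm.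
  refine ⟨c⁻¹ * Fintype.card X, -Real.log c, by positivity, neg_pos.2 (Real.log_neg hc0 hc1),
    fun s hs v hv => ?_⟩
  have h1 : Φ s v = Φ (s - ⌊s⌋₊) (Φ ⌊s⌋₊ v) := by
    conv_lhs => rw [← sub_add_cancel s (⌊s⌋₊ : ℝ)]
    exact LinearODE.exp_add_smul_apply _ _ _ _
  have h2 : ∑ y, |Φ s v y| ≤ c ^ ⌊s⌋₊ * ∑ x, |v x| := by
    rw [h1]
    exact (hle _ (sub_nonneg.2 (Nat.floor_le hs)) _ (hsum _ (Nat.cast_nonneg _) v hv)).trans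
      (hpow _ v hv)
  have h3 : ‖Φ s v‖ ≤ ∑ y, |Φ s v y| :=
    (pi_norm_le_iff_of_nonneg (Finset.sum_nonneg fun _ _ => abs_nonneg _)).2 fun y =>
      Finset.single_le_sum (f := fun y => |Φ s v y|) (fun _ _ => abs_nonneg _) (Finset.mem_univ y)
  have h4 : ∑ x, |v x| ≤ Fintype.card X * ‖v‖ := by
    refine (Finset.sum_le_sum fun x _ => norm_le_pi_norm v x).trans (le_of_eq ?_)
    simp
  have h5 : c ^ ⌊s⌋₊ ≤ c⁻¹ * Real.exp (-(-Real.log c) * s) := by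
    rw [neg_neg, ← Real.rpow_def_of_pos hc0, ← Real.rpow_neg_one, ← Real.rpow_add hc0,
      ← Real.rpow_natCast]
    exact Real.rpow_le_rpow_of_exponent_ge hc0 hc1.le (by linarith [Nat.lt_floor_add_one s])
  calc ‖Φ s v‖ ≤ c ^ ⌊s⌋₊ * ∑ x, |v x| := h3.trans h2
    _ ≤ (c⁻¹ * Real.exp (-(-Real.log c) * s)) * (Fintype.card X * ‖v‖) :=
        mul_le_mul h5 h4 (Finset.sum_nonneg fun _ _ => abs_nonneg _) (by positivity)
    _ = _ := by ring

/-- Convolution of the semigroup with a bounded function of total mass zero. -/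
lemma exists_integrableOn_exp_forwardGen (hr : ∀ x y, 0 ≤ r x y) (hpos : ∀ x, 0 < ∑ y, r x y)
    (hirr : IsIrreducible r) :
    ∃ K : ℝ, 0 ≤ K ∧ ∀ (f : ℝ → X → ℝ) (M : ℝ), Measurable f → (∀ u, ‖f u‖ ≤ M) →
      (∀ u, ∑ x, f u x = 0) → ∀ t : ℝ,
      IntegrableOn (fun s : ℝ => NormedSpace.exp (s • forwardGen r) (f (t - s))) (Ioi 0) ∧
      ‖∫ s in Ioi (0 : ℝ), NormedSpace.exp (s • forwardGen r) (f (t - s))‖ ≤ K * M := by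
  obtain ⟨K, b, hK, hb, h⟩ := exists_norm_exp_forwardGen_le hr hpos hirr
  have hexp : IntegrableOn (fun s => Real.exp (-b * s)) (Ioi 0) :=
    integrableOn_exp_mul_Ioi (neg_neg_iff_pos.2 hb) 0
  -- The constant depends on `r` alone, not on `f` or `t`: this uniformity makes the later remainder
  -- estimates uniform in λ.
  refine ⟨K * ∫ s in Ioi (0 : ℝ), Real.exp (-b * s), mul_nonneg hK
    (integral_nonneg fun s => (Real.exp_pos _).le), fun f M hf hM hsum t => ?_⟩
  have hbound : ∀ s ∈ Ioi (0 : ℝ), ‖NormedSpace.exp (s • forwardGen r) (f (t - s))‖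
      ≤ K * Real.exp (-b * s) * M := fun s hs =>
    (h s (mem_Ioi.1 hs).le _ (hsum _)).trans
      (mul_le_mul_of_nonneg_left (hM _) (mul_nonneg hK (Real.exp_pos _).le))
  have hint := (hexp.const_mul K).mul_const M
  have hae : ∀ᵐ s ∂(volume.restrict (Ioi (0 : ℝ))),
      ‖NormedSpace.exp (s • forwardGen r) (f (t - s))‖ ≤ K * Real.exp (-b * s) * M :=
    (ae_restrict_iff' measurableSet_Ioi).2 (Filter.Eventually.of_forall hbound)
  constructor
  · refine Integrable.mono' hint ?_ hae
    exact (ContinuousLinearMap.apply ℝ (X → ℝ)).flip.aestronglyMeasurable_comp₂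
      (LinearODE.continuous_exp_smul _).aestronglyMeasurable
      (hf.comp (measurable_const.sub measurable_id)).aestronglyMeasurable
  · refine (norm_integral_le_of_norm_le hint hae).trans (le_of_eq ?_)
    rw [integral_mul_const, integral_const_mul]

/-- Take the law `ν` invariant over one time unit. Its marginal at any time `t` is again invariant
over one unit, as the two time shifts commute, hence equals `ν` by uniqueness. -/
lemma existsUnique_isInvariant (hirr : IsIrreducible r) :
    ∃! π : X → ℝ, (unperturbed r hr hpos).IsInvariant π := by
  set R := unperturbed r hr hpos with hR
  have hper : ∀ T t, R.rate (t + T) = R.rate t := fun T t => rfl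
  obtain ⟨ν, ⟨hν, hνT⟩, huniq⟩ := R.existsUnique_isPeriodicInvariant
    (unperturbed_reflTransGen hirr) one_pos
  refine ⟨ν, ⟨hν, fun t ht => huniq _ ⟨R.marginal_mem_stdSimplex hν ht, ?_⟩⟩,
    fun μ hμ => huniq μ ⟨hμ.1, hμ.2 1 zero_le_one⟩⟩
  rw [← R.marginal_add_period hν ht (hper t) zero_le_one, add_comm,
    R.marginal_add_period hν zero_le_one (hper 1) ht, hνT]

/-- The deviation of a periodic solution from the invariant distribution, as a convolution. -/
theorem marginal_sub_eq_integral (hirr : IsIrreducible r) {π : X → ℝ}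
    (hπ : (unperturbed r hr hpos).IsInvariant π) (R : JumpRates X) {T : ℝ} (hT : 0 < T)
    (hR : ∀ t, R.rate (t + T) = R.rate t) {ν : X → ℝ} (hν : R.IsPeriodicInvariant T ν) :
    ∃ p : ℝ → X → ℝ, Measurable p ∧ (∀ t, p t ∈ stdSimplex ℝ X) ∧
      (∀ t, ∃ u, 0 ≤ u ∧ p t = R.marginal ν u) ∧ ∀ t, 0 ≤ t → R.marginal ν t - π =
        ∫ s in Ioi (0 : ℝ), NormedSpace.exp (s • forwardGen r)
          (forwardGen (fun x y => R.rate (t - s) x y - r x y) (p (t - s))) := by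
  obtain ⟨hsol, hν0⟩ := R.isForwardSolution_marginal hν.1
  -- The marginals are extended periodically to negative times, because the convolution reaches into
  -- the whole past.
  set p : ℝ → X → ℝ := fun t => R.marginal ν (T * Int.fract (t / T)) with hp
  have hpm : Measurable p :=
    hsol.measurable.comp ((measurable_fract.comp (measurable_id.div_const T)).const_mul T)
  have hnn : ∀ t : ℝ, 0 ≤ T * Int.fract (t / T) := fun t => mul_nonneg hT.le (Int.fract_nonneg _)
  have hps : ∀ t, p t ∈ stdSimplex ℝ X := fun t => R.marginal_mem_stdSimplex hν.1 (hnn t)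
  have hshift : ∀ (n : ℕ) (t : ℝ), 0 ≤ t → R.marginal ν (t + n * T) = R.marginal ν t := by
    intro n
    induction n with
    | zero => intro t _; simp
    | succ n ih =>
      intro t ht
      rw [Nat.cast_succ, add_mul, one_mul, ← add_assoc,
        R.marginal_add_period hν.1 hT.le hR (by positivity), hν.2, ih t ht]
  have hpp : ∀ t, 0 ≤ t → p t = R.marginal ν t := by
    intro t ht
    have h1 : 0 ≤ ⌊t / T⌋ := Int.floor_nonneg.2 (div_nonneg ht hT.le)
    obtain ⟨n, hn⟩ := Int.eq_ofNat_of_zero_le h1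
    rw [hp]
    simp only
    rw [← hshift n _ (hnn t)]
    congr 1
    rw [Int.fract, hn]
    push_cast
    field_simp
    ring
  set F : ℝ → X → ℝ := fun u => forwardGen (fun x y => R.rate u x y - r x y) (p u) with hF
  have hpper : Function.Periodic p T := fun t => by
    simp only [hp]
    rw [add_div, div_self hT.ne', Int.fract_add_one]
  have hFper : Function.Periodic F T := fun t => by
    simp only [hF, hpper t, hR]
  have hFm : Measurable F := measurable_forwardGen
    (ρ := fun u x y => R.rate u x y - r x y) (fun x y => (R.measurable_rate x y).sub_const _) hpm
  have hFeq : ∀ u, F u = forwardGen (R.rate u) (p u) - forwardGen r (p u) := by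
    intro u
    have := forwardGen_add (fun x y => R.rate u x y - r x y) r (p u)
    simp only [sub_add_cancel] at this
    rw [hF, this, add_sub_cancel_right]
  have hpn : ∀ u, ‖p u‖ ≤ 1 := fun u => norm_le_one_of_mem_stdSimplex (hps u)
  obtain ⟨C, hC0, hC⟩ := R.exists_norm_forwardGen_le
  obtain ⟨D, hD⟩ := hsol.exists_norm_le
  have hFM : ∀ u, ‖F u‖ ≤ C + ‖forwardGen r‖ := fun u => by
    rw [hFeq]
    exact (norm_sub_le _ _).trans (add_le_add
      ((hC u _).trans (mul_le_of_le_one_right hC0 (hpn u)))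
      (((forwardGen r).le_opNorm _).trans (mul_le_of_le_one_right (norm_nonneg _) (hpn u))))
  have hFs : ∀ u, ∑ x, F u x = 0 := fun u => sum_forwardGen _ _
  obtain ⟨K, -, hK⟩ := exists_integrableOn_exp_forwardGen hr hpos hirr
  refine ⟨p, hpm, hps, fun t => ⟨_, hnn t, rfl⟩, fun t ht => ?_⟩
  -- Variation of constants over `[0, t + n * T]`, moved back by `n` periods. As `n → ∞` the initial
  -- term vanishes, since `ν - π` has mass zero, and the integral extends to `(0, ∞)`.
  have hformula : ∀ n : ℕ, R.marginal ν t - π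
      = NormedSpace.exp ((t + n * T) • forwardGen r) (ν - π) +
        ∫ s in (0 : ℝ)..(t + n * T), NormedSpace.exp (s • forwardGen r) (F (t - s)) := by
    intro n
    have htn : 0 ≤ t + n * T := by positivity
    have hd := LinearODE.duhamel (forwardGen r)
      (h := fun u => forwardGen (R.rate u) (R.marginal ν u)) (f := F) (p₀ := ν)
      (M := D + (C + ‖forwardGen r‖))
      hsol.intervalIntegrable
      (fun a b => LinearODE.intervalIntegrable_of_norm_le hFm.aestronglyMeasurable hFM a b)
      (fun u => (hD u).trans (le_add_of_nonneg_right (by positivity)))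
      (fun u => (hFM u).trans (le_add_of_nonneg_left ((norm_nonneg _).trans (hD 0)))) htn
      (fun u hu => by
        have := hsol.eq_add_integral u hu
        rw [hν0] at this
        rw [← this, hFeq, hpp u hu]
        abel)
    have h1 := hsol.eq_add_integral (t + n * T) htn
    rw [hν0] at h1
    rw [← h1, hshift n t ht] at hd
    have hπe : NormedSpace.exp ((t + n * T) • forwardGen r) π = π := by
      obtain ⟨h2, h3⟩ := (unperturbed r hr hpos).isForwardSolution_marginal hπ.1
      have := exp_forwardGen_eq h2 htn
      rwa [h3, hπ.2 _ htn] at this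
    rw [hd, map_sub, hπe]
    have hFF : ∀ s, F (t + n * T - s) = F (t - s) := fun s => by
      rw [show t + n * T - s = t - s + n * T by ring]
      exact (hFper.nat_mul n) _
    simp only [hFF]
    abel
  obtain ⟨K', b, -, hb, hexp⟩ := exists_norm_exp_forwardGen_le hr hpos hirr
  have htend : Filter.Tendsto (fun n : ℕ => t + n * T) Filter.atTop Filter.atTop :=
    Filter.tendsto_atTop_add_const_left _ _
      (tendsto_natCast_atTop_atTop.atTop_mul_const hT)
  have hz : Filter.Tendsto (fun n : ℕ => NormedSpace.exp ((t + n * T) • forwardGen r) (ν - π))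
      Filter.atTop (nhds 0) := by
    have h0 : Filter.Tendsto (fun n : ℕ => K' * Real.exp (-b * (t + n * T)) * ‖ν - π‖)
        Filter.atTop (nhds 0) := by
      have h1 : Filter.Tendsto (fun n : ℕ => Real.exp (-b * (t + n * T))) Filter.atTop (nhds 0) :=
        Real.tendsto_exp_atBot.comp (htend.const_mul_atTop_of_neg (neg_neg_iff_pos.2 hb))
      simpa using (h1.const_mul K').mul_const ‖ν - π‖
    refine squeeze_zero_norm (fun n => hexp _ (by positivity) _ ?_) h0
    simp only [Pi.sub_apply, Finset.sum_sub_distrib, hν.1.2, hπ.1.2, sub_self]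
  have hlim := hz.add (intervalIntegral_tendsto_integral_Ioi 0
    (hK F _ hFm hFM hFs t).1 htend)
  rw [zero_add] at hlim
  exact tendsto_nhds_unique (tendsto_const_nhds.congr hformula) hlim

end MarkovChain

/-! ### Linear response and conjugation with the adjoint generator -/

lemma hasDerivAt_zero_of_norm_sub_le {E : Type*} [NormedAddCommGroup E] [NormedSpace ℝ E]
    {F : ℝ → E} {a I : E} {C ε : ℝ} (hε : 0 < ε)
    (h : ∀ l, |l| ≤ ε → ‖F l - a - l • I‖ ≤ C * l ^ 2) : HasDerivAt F I 0 := by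
  have hO : (fun l => F l - a - l • I) =O[nhds 0] fun l => ‖l - (0 : ℝ)‖ ^ 2 := by
    refine Asymptotics.IsBigO.of_bound C ?_
    filter_upwards [Metric.closedBall_mem_nhds (0 : ℝ) hε] with l hl
    rw [mem_closedBall_zero_iff, Real.norm_eq_abs] at hl
    simpa using h l hl
  have h1 := (hO.hasFDerivAt one_lt_two).hasDerivAt
  have h2 := (h1.add_const a).add ((hasDerivAt_id (0 : ℝ)).smul_const I)
  refine (h2.congr_deriv (by simp)).congr_of_eventuallyEq (Filter.Eventually.of_forall fun l => ?_)
  simp only [Pi.add_apply, id_eq]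
  abel

namespace MarkovChain

variable {X : Type*} [Fintype X] {r : X → X → ℝ}

/-- Multiplication by a function. -/
noncomputable def mulCLM (w : X → ℝ) : (X → ℝ) →L[ℝ] (X → ℝ) := ContinuousLinearMap.mul ℝ (X → ℝ) w

lemma mulCLM_apply (w f : X → ℝ) (x : X) : mulCLM w f x = w x * f x := rfl

/-- Multiplication by `π` carries densities to distributions. Stationarity of `π` enters in the
diagonal term: the total rates out of a state agree for `r*` and `r`. -/
lemma mulCLM_LStar {π : X → ℝ} (hπ : ∀ x, 0 < π x) (h0 : forwardGen r π = 0) (f : X → ℝ) :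
    mulCLM π (LStar r π f) = forwardGen r (mulCLM π f) := by
  funext y
  have h1 : ∑ x, π x * r x y = ∑ x, π y * r y x := by
    have := congrFun h0 y
    rwa [forwardGen_apply, Finset.sum_sub_distrib, Pi.zero_apply, sub_eq_zero] at this
  have h2 : mulCLM π (LStar r π f) y = π y * ∑ x, rStar r π y x * (f x - f y) := rfl
  have h3 : ∀ x, π y * (rStar r π y x * (f x - f y)) = π x * f x * r x y - f y * (π x * r x y) := by
    intro x
    have := (hπ y).ne'
    unfold rStar
    field_simp
  rw [h2, forwardGen_apply, Finset.mul_sum]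
  simp only [h3, mulCLM_apply]
  rw [Finset.sum_sub_distrib, Finset.sum_sub_distrib, ← Finset.mul_sum, h1, Finset.mul_sum]
  congr 1
  exact Finset.sum_congr rfl fun x _ => by ring

lemma mulCLM_exp_LStar {π : X → ℝ} (hπ : ∀ x, 0 < π x) (h0 : forwardGen r π = 0) (s : ℝ)
    (f : X → ℝ) :
    mulCLM π (NormedSpace.exp (s • LStar r π) f)
      = NormedSpace.exp (s • forwardGen r) (mulCLM π f) := by
  let _ : NormedAlgebra ℚ ((X → ℝ) →L[ℝ] (X → ℝ)) :=
    NormedAlgebra.restrictScalars ℚ ℝ ((X → ℝ) →L[ℝ] (X → ℝ))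
  have h : SemiconjBy (mulCLM π) (s • LStar r π) (s • forwardGen r) := by
    ext1 v
    change mulCLM π (s • LStar r π v) = s • forwardGen r (mulCLM π v)
    rw [map_smul, mulCLM_LStar hπ h0]
  exact DFunLike.congr_fun h.exp_right f

lemma mulCLM_inv_mulCLM {π : X → ℝ} (hπ : ∀ x, 0 < π x) (f : X → ℝ) :
    mulCLM π⁻¹ (mulCLM π f) = f := by
  funext x
  rw [mulCLM_apply, mulCLM_apply, Pi.inv_apply, inv_mul_cancel_left₀ (hπ x).ne']

/-- The rates `r * g u` are the λ-derivative of the perturbed rates at 0, so ψ is the density of the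
first-order forcing of `π`. -/
lemma mulCLM_psi {π : X → ℝ} (hπ : ∀ x, 0 < π x) (g : ℝ → X → X → ℝ) (u : ℝ) :
    mulCLM π (psi r g π u) = forwardGen (fun x y => r x y * g u x y) π := by
  funext y
  rw [mulCLM_apply, psi, forwardGen_apply, Finset.mul_sum]
  refine Finset.sum_congr rfl fun x _ => ?_
  have := (hπ y).ne'
  unfold rStar
  field_simp

lemma exp_LStar_psi {π : X → ℝ} (hπ : ∀ x, 0 < π x) (h0 : forwardGen r π = 0)
    (g : ℝ → X → X → ℝ) (s u : ℝ) :
    NormedSpace.exp (s • LStar r π) (psi r g π u) = mulCLM π⁻¹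
      (NormedSpace.exp (s • forwardGen r) (forwardGen (fun x y => r x y * g u x y) π)) := by
  rw [← mulCLM_psi hπ, ← mulCLM_exp_LStar hπ h0, mulCLM_inv_mulCLM hπ]

variable {hr : ∀ x y, 0 ≤ r x y} {hpos : ∀ x, 0 < ∑ y, r x y} {g : ℝ → X → X → ℝ}
  {hgm : ∀ x y, Measurable fun t => g t x y} {hgb : ∃ G : ℝ, ∀ t x y, |g t x y| ≤ G}

lemma perturbed_reflTransGen (hirr : IsIrreducible r) (l : ℝ) (x y : X) :
    Relation.ReflTransGen
      (fun a b => ∀ u, 0 < (perturbed r hr hpos g hgm hgb l).rate u a b) x y :=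
  Relation.ReflTransGen.mono (fun _ _ h _ => mul_pos (Real.exp_pos _) h) _ _ (hirr x y)

lemma perturbed_rate_add_period {T : ℝ} (hper : ∀ x y, Function.Periodic (fun t => g t x y) T)
    (l t : ℝ) : (perturbed r hr hpos g hgm hgb l).rate (t + T)
      = (perturbed r hr hpos g hgm hgb l).rate t := by
  funext x y
  have := hper x y t
  simp only at this
  simp only [perturbed, this]

variable [MeasurableSpace X] [MeasurableSingletonClass X]

lemma pos_of_isInvariant (hirr : IsIrreducible r) {π : X → ℝ}
    (hπ : (unperturbed r hr hpos).IsInvariant π) (x : X) : 0 < π x := by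
  have := (unperturbed r hr hpos).marginal_pos (unperturbed_reflTransGen hirr) hπ.1 one_pos x
  rwa [hπ.2 1 zero_le_one] at this

variable [Nonempty X]

/-- Linear response of the marginals of the oscillatory steady state. -/
theorem hasDerivAt_marginal (hirr : IsIrreducible r) {T : ℝ} (hT : 0 < T)
    (hper : ∀ x y, Function.Periodic (fun t => g t x y) T) {π : X → ℝ}
    (hπ : (unperturbed r hr hpos).IsInvariant π) {oss : ℝ → X → ℝ}
    (hoss : ∀ l, (perturbed r hr hpos g hgm hgb l).IsPeriodicInvariant T (oss l)) {t : ℝ}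
    (ht : 0 ≤ t) :
    IntegrableOn (fun s : ℝ => NormedSpace.exp (s • forwardGen r)
      (forwardGen (fun x y => r x y * g (t - s) x y) π)) (Ioi 0) ∧
    HasDerivAt (fun l => (perturbed r hr hpos g hgm hgb l).marginal (oss l) t)
      (∫ s in Ioi (0 : ℝ), NormedSpace.exp (s • forwardGen r)
        (forwardGen (fun x y => r x y * g (t - s) x y) π)) 0 := by
  obtain ⟨G₀, hG₀⟩ := hgb
  obtain ⟨M₀, hM₀⟩ := exists_rate_upper_bound r hr
  -- A strictly positive bound on |g|; for `|l| ≤ G⁻¹` the exponents `l * g` stay in `[-1, 1]`,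
  -- where the Taylor estimates for the exponential hold.
  set G := |G₀| + 1 with hGdef
  have hG1 : 0 < G := by positivity
  have hG : ∀ t x y, |g t x y| ≤ G := fun t x y =>
    (hG₀ t x y).trans ((le_abs_self _).trans (by linarith))
  set M := |M₀| with hMdef
  have hM0 : 0 ≤ M := abs_nonneg _
  have hM : ∀ x y, |r x y| ≤ M := fun x y => by
    rw [abs_of_nonneg (hr x y)]
    exact (hM₀ x y).trans (le_abs_self _)
  set c : ℝ := 2 * Fintype.card X with hc
  have hc0 : 0 ≤ c := by positivity
  obtain ⟨K, hK0, hK⟩ := exists_integrableOn_exp_forwardGen hr hpos hirr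
  set B : ℝ → X → ℝ := fun u => forwardGen (fun x y => r x y * g u x y) π with hB
  have hρ : ∀ u x y, |r x y * g u x y| ≤ M * G := fun u x y => by
    rw [abs_mul]
    exact mul_le_mul (hM x y) (hG u x y) (abs_nonneg _) hM0
  have hMG : 0 ≤ M * G := mul_nonneg hM0 hG1.le
  have hBm : Measurable B := measurable_forwardGen (ρ := fun u x y => r x y * g u x y)
    (fun x y => (hgm x y).const_mul _) measurable_const
  have hBM : ∀ u, ‖B u‖ ≤ c * (M * G) := fun u =>
    (norm_forwardGen_le hMG (hρ u) π).trans
      (mul_le_of_le_one_right (by positivity) (norm_le_one_of_mem_stdSimplex hπ.1))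
  have hBs : ∀ u, ∑ x, B u x = 0 := fun u => sum_forwardGen _ _
  refine ⟨(hK B _ hBm hBM hBs t).1, ?_⟩
  set D := c * (2 * (M * G)) with hD
  have hD0 : 0 ≤ D := by positivity
  -- `K` is the convolution bound. Inside it stand the second-order remainder of the rates and the
  -- first-order operator acting on the deviation from `π`, itself at most `K * D * |l|`.
  refine hasDerivAt_zero_of_norm_sub_le (a := π) (C := K * (c * (M * G ^ 2) + c * (M * G) * (K * D)))
    (ε := G⁻¹) (inv_pos.2 hG1) fun l hl => ?_
  set R := perturbed r hr hpos g hgm ⟨G₀, hG₀⟩ l with hR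
  obtain ⟨p, hpm, hps, hpv, hform⟩ := marginal_sub_eq_integral hirr hπ R hT
    (perturbed_rate_add_period hper l) (hoss l)
  have hp1 : ∀ u, ‖p u‖ ≤ 1 := fun u => norm_le_one_of_mem_stdSimplex (hps u)
  have hlg : ∀ u x y, |l * g u x y| ≤ 1 ∧ |l * g u x y| ≤ |l| * G := fun u x y => by
    have h1 : |l * g u x y| ≤ |l| * G := by
      rw [abs_mul]
      exact mul_le_mul_of_nonneg_left (hG u x y) (abs_nonneg _)
    refine ⟨h1.trans ?_, h1⟩
    calc |l| * G ≤ G⁻¹ * G := mul_le_mul_of_nonneg_right hl hG1.le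
      _ = 1 := inv_mul_cancel₀ hG1.ne'
  set F : ℝ → X → ℝ := fun u => forwardGen (fun x y => R.rate u x y - r x y) (p u) with hF
  have hFm : Measurable F := measurable_forwardGen
    (ρ := fun u x y => R.rate u x y - r x y) (fun x y => (R.measurable_rate x y).sub_const _) hpm
  have hFs : ∀ u, ∑ x, F u x = 0 := fun u => sum_forwardGen _ _
  have hFM : ∀ u, ‖F u‖ ≤ D * |l| := by
    intro u
    have hb : ∀ x y, |R.rate u x y - r x y| ≤ 2 * (M * G) * |l| := fun x y => by
      have e : R.rate u x y - r x y = (Real.exp (l * g u x y) - 1) * r x y := by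
        simp only [hR, perturbed]
        ring
      rw [e, abs_mul]
      have h1 := Real.abs_exp_sub_one_le (hlg u x y).1
      calc |Real.exp (l * g u x y) - 1| * |r x y| ≤ (2 * (|l| * G)) * M :=
            mul_le_mul (h1.trans (by linarith [(hlg u x y).2])) (hM x y) (abs_nonneg _)
              (by positivity)
        _ = 2 * (M * G) * |l| := by ring
    refine (norm_forwardGen_le (by positivity) hb (p u)).trans
      ((mul_le_of_le_one_right (by positivity) (hp1 u)).trans (le_of_eq ?_))
    rw [hD, hc]
    ring
  -- A bootstrap: the exact formula with the crude bound `‖p‖ ≤ 1` already shows that the deviation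
  -- is of first order.
  have hdev : ∀ u, ‖p u - π‖ ≤ K * (D * |l|) := by
    intro u
    obtain ⟨v, hv, hpu⟩ := hpv u
    rw [hpu, hform v hv]
    exact (hK F _ hFm hFM hFs v).2
  have hdiff : ∀ u, ‖F u - l • B u‖ ≤ (c * (M * G ^ 2) + c * (M * G) * (K * D)) * l ^ 2 := by
    intro u
    -- The quadratic Taylor remainder of the rates acts on `p`, and the linear part of order `l`
    -- acts on `p - π`; both are of order `l ^ 2`.
    have e : F u - l • B u
        = forwardGen (fun x y => R.rate u x y - r x y - l * (r x y * g u x y)) (p u)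
          + l • forwardGen (fun x y => r x y * g u x y) (p u - π) := by
      have h1 := forwardGen_add (fun x y => R.rate u x y - r x y - l * (r x y * g u x y))
        (fun x y => l * (r x y * g u x y)) (p u)
      simp only [sub_add_cancel] at h1
      rw [forwardGen_smul] at h1
      simp only [hF, hB]
      rw [h1, map_sub, smul_sub]
      abel
    have hb : ∀ x y, |R.rate u x y - r x y - l * (r x y * g u x y)| ≤ M * G ^ 2 * l ^ 2 :=
      fun x y => by
        have e : R.rate u x y - r x y - l * (r x y * g u x y)
            = (Real.exp (l * g u x y) - 1 - l * g u x y) * r x y := by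
          simp only [hR, perturbed]
          ring
        rw [e, abs_mul]
        have h1 := Real.abs_exp_sub_one_sub_id_le (hlg u x y).1
        have h2 : (l * g u x y) ^ 2 ≤ (|l| * G) ^ 2 := sq_le_sq' (by
          linarith [neg_abs_le (l * g u x y), (hlg u x y).2]) ((le_abs_self _).trans (hlg u x y).2)
        calc |Real.exp (l * g u x y) - 1 - l * g u x y| * |r x y| ≤ (|l| * G) ^ 2 * M :=
              mul_le_mul (h1.trans h2) (hM x y) (abs_nonneg _) (by positivity)
          _ = M * G ^ 2 * l ^ 2 := by rw [mul_pow, sq_abs]; ring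
    have h1 := (norm_forwardGen_le (by positivity) hb (p u)).trans
      (mul_le_of_le_one_right (by positivity) (hp1 u))
    have h2 := (norm_forwardGen_le hMG (hρ u) (p u - π)).trans
      (mul_le_mul_of_nonneg_left (hdev u) (by positivity))
    rw [e]
    refine (norm_add_le _ _).trans ?_
    rw [norm_smul, Real.norm_eq_abs]
    have h3 := mul_le_mul_of_nonneg_left h2 (abs_nonneg l)
    refine (add_le_add h1 h3).trans (le_of_eq ?_)
    rw [← sq_abs l, hc]
    ring
  have hdm : Measurable fun u => F u - l • B u := hFm.sub (hBm.const_smul l)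
  have hds : ∀ u, ∑ x, (F u - l • B u) x = 0 := fun u => by
    simp only [Pi.sub_apply, Pi.smul_apply, smul_eq_mul, Finset.sum_sub_distrib, ← Finset.mul_sum,
      hFs, hBs, mul_zero, sub_zero]
  have h1 := (hK F _ hFm hFM hFs t).1
  have h2 := (hK B _ hBm hBM hBs t).1
  have h3 := (hK _ _ hdm hdiff hds t).2
  simp only [map_sub, map_smul] at h3
  rw [integral_sub h1 (g := fun s => l • NormedSpace.exp (s • forwardGen r) (B (t - s)))
    (h2.smul l), integral_smul] at h3
  rw [hform t ht, mul_assoc]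
  exact h3

theorem linear_response (hirr : IsIrreducible r) {T : ℝ} (hT : 0 < T)
    (hper : ∀ x y, Function.Periodic (fun t => g t x y) T) {π : X → ℝ}
    (hπ : (unperturbed r hr hpos).IsInvariant π) {oss : ℝ → X → ℝ}
    (hoss : ∀ l, (perturbed r hr hpos g hgm hgb l).IsPeriodicInvariant T (oss l)) {t : ℝ}
    (ht : 0 ≤ t) :
    (∀ x, DifferentiableAt ℝ
      (fun l => (perturbed r hr hpos g hgm hgb l).marginal (oss l) t x) 0) ∧
    IntegrableOn (fun s : ℝ =>
      NormedSpace.exp (s • LStar r π) (psi r g π (t - s))) (Ioi 0) ∧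
    (fun x => deriv (fun l => (perturbed r hr hpos g hgm hgb l).marginal (oss l) t x) 0 / π x) =
      ∫ s in Ioi (0 : ℝ), NormedSpace.exp (s • LStar r π) (psi r g π (t - s)) := by
  have hπ0 := pos_of_isInvariant hirr hπ
  have h0 := forwardGen_eq_zero_of_isInvariant hπ
  obtain ⟨hint, hder⟩ := hasDerivAt_marginal hirr hT hper hπ hoss ht
  have hder' := fun x => hasDerivAt_pi.1 hder x
  simp only [exp_LStar_psi hπ0 h0]
  refine ⟨fun x => (hder' x).differentiableAt, (mulCLM π⁻¹).integrable_comp hint, ?_⟩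
  rw [(mulCLM π⁻¹).integral_comp_comm hint]
  funext x
  rw [(hder' x).deriv, mulCLM_apply, Pi.inv_apply, div_eq_inv_mul]

end MarkovChain

/-! ### Assembly -/

theorem mainTheorem7 {X : Type*} [Fintype X] [Nonempty X] [MeasurableSpace X]
    [MeasurableSingletonClass X]
    (r : X → X → ℝ) (hr : ∀ x y, 0 ≤ r x y) (hpos : ∀ x, 0 < ∑ y, r x y)
    (hirr : MarkovChain.IsIrreducible r)
    (g : ℝ → X → X → ℝ) (hgm : ∀ x y, Measurable fun t => g t x y)
    (hgb : ∃ G : ℝ, ∀ t x y, |g t x y| ≤ G)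
    (T : ℝ) (hT : 0 < T) (hper : ∀ x y, Function.Periodic (fun t => g t x y) T) :
    (∃! π : X → ℝ, (MarkovChain.unperturbed r hr hpos).IsInvariant π) ∧
    (∀ lam : ℝ, ∃! ν : X → ℝ,
      (MarkovChain.perturbed r hr hpos g hgm hgb lam).IsPeriodicInvariant T ν) ∧
    ∀ π : X → ℝ, (MarkovChain.unperturbed r hr hpos).IsInvariant π →
    ∀ oss : ℝ → X → ℝ,
      (∀ lam, (MarkovChain.perturbed r hr hpos g hgm hgb lam).IsPeriodicInvariant T (oss lam)) →
      (∀ x, 0 < π x) ∧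
      -- the linear response of the initial distribution of the oscillatory steady state
      (∀ x, DifferentiableAt ℝ (fun lam => oss lam x) 0) ∧
      IntegrableOn (fun s : ℝ =>
        NormedSpace.exp (s • MarkovChain.LStar r π) (MarkovChain.psi r g π (-s))) (Ioi 0) ∧
      (fun x => deriv (fun lam => oss lam x) 0 / π x) =
        ∫ s in Ioi (0 : ℝ),
          NormedSpace.exp (s • MarkovChain.LStar r π) (MarkovChain.psi r g π (-s)) ∧
      -- the linear response of the marginal at time `t` of the oscillatory steady state
      ∀ t : ℝ, 0 ≤ t →
        (∀ x, DifferentiableAt ℝ (fun lam =>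
          (MarkovChain.perturbed r hr hpos g hgm hgb lam).marginal (oss lam) t x) 0) ∧
        IntegrableOn (fun s : ℝ =>
          NormedSpace.exp (s • MarkovChain.LStar r π) (MarkovChain.psi r g π (t - s))) (Ioi 0) ∧
        (fun x => deriv (fun lam =>
          (MarkovChain.perturbed r hr hpos g hgm hgb lam).marginal (oss lam) t x) 0 / π x) =
          ∫ s in Ioi (0 : ℝ),
            NormedSpace.exp (s • MarkovChain.LStar r π) (MarkovChain.psi r g π (t - s)) := by
  refine ⟨MarkovChain.existsUnique_isInvariant hirr, fun lam =>
    JumpRates.existsUnique_isPeriodicInvariant _ (MarkovChain.perturbed_reflTransGen hirr lam) hT,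
    fun π hπ oss hoss => ⟨MarkovChain.pos_of_isInvariant hirr hπ, ?_⟩⟩
  -- The marginal at time 0 is the initial law, so the response of `oss` is the case `t = 0`.
  have hzero : ∀ lam, (MarkovChain.perturbed r hr hpos g hgm hgb lam).marginal (oss lam) 0
      = oss lam := fun lam => (JumpRates.isForwardSolution_marginal _ (hoss lam).1).2
  have h := MarkovChain.linear_response hirr hT hper hπ hoss le_rfl
  simp only [hzero, zero_sub] at h
  exact ⟨h.1, h.2.1, h.2.2, fun t ht => MarkovChain.linear_response hirr hT hper hπ hoss ht⟩
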